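/- Let $\overline{\mathbf F}$ be an algebraic closure of $\mathbf F_2$. Let $C_0=\mathbb P^1$ with affine coordinate $x_0$, and for $n\ge 0$ let $C_{n+1}\to C_n$ be the cover of smooth projective curves over $\overline{\mathbf F}$ given by the affine equation $$x_{n+1}^2+x_{n+1}=x_n+1+\frac1{x_n},$$ so that $C_n$ has function field $\overline{\mathbf F}(x_0,\ldots,x_n)$. Write $P(a_0,\ldots,a_n)$ for any point $P$ of $C_n$ with $x_m(P)=a_m\in\mathbb P^1(\overline{\mathbf F})$ for $0\le m\le n$ (such a point need not be unique), and write $\infty^j$ for $j$ consecutive entries $\infty$. Theorem. Let $i\ge 1$, $j\ge 0$ and let $P=P(a_0,\ldots,a_{i-1},0,\infty^j)$ be a point of $C_{i+j}$ with $a_0=1$ (it is a pole of $x_{i+j}$ if $j\ge 1$, and of $1/x_i$ if $j=0$; for such a point to exist, $i$ has to be even). 1. If $j\in\{0,2,4,\ldots,i-2\}$ or $j\ge i$, then $P$ is totally ramified in $C_{i+j+1}/C_{i+j}$, and its contribution to the ramification divisor of $C_{i+j+1}/C_{i+j}$ is $2$. 2. If $j\in\{1,3,5,\ldots,i-1\}$,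 then $P$ is unramified in $C_{i+j+1}/C_{i+j}$. -/

import Mathlib

/-! ## Points of smooth projective curves over an algebraically closed field

The smooth projective curve with function field `K / k` is described in the classical way: its
(closed) points are the valuation rings of `K / k`, i.e. the valuation rings `𝒪` with
`k ⊆ 𝒪 ⊊ K`; the ring `𝒪` belonging to a point is the local ring of the curve at that point. -/

/-- A point of the smooth projective curve with function field `K` over `k`. -/
structure CurvePoint (k K : Type*) [Field k] [Field K] [Algebra k K] where
  /-- The local ring of the curve at the point. -/
  ring : ValuationSubring K
  const_mem : ∀ c : k, algebraMap k K c ∈ ring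
  ne_top : ring ≠ ⊤

namespace CurvePoint

/-- `P.HasValue f a` says that `f(P) = a`, where `a ∈ ℙ¹(k) = k ∪ {∞}`: the value is `∞` when `f`
is not regular at `P`, and it is `c ∈ k` when `f - c` lies in the maximal ideal at `P`. -/
def HasValue {k K : Type*} [Field k] [Field K] [Algebra k K]
    (P : CurvePoint k K) (f : K) (a : OnePoint k) : Prop :=
  (a = OnePoint.infty ∧ f ∉ P.ring) ∨
    ∃ c : k, a = (c : OnePoint k) ∧ f - algebraMap k K c ∈ P.ring.nonunits

/-- The morphism of curves belonging to an algebraic extension `L / K` of function fields, on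
points: the point `Q` is sent to the point with local ring `𝒪_Q ∩ K`. -/
def image {k : Type*} (K : Type*) {L : Type*} [Field k] [Field K] [Field L]
    [Algebra k K] [Algebra k L] [Algebra K L] [IsScalarTower k K L] [Algebra.IsAlgebraic K L]
    (Q : CurvePoint k L) : CurvePoint k K where
  ring := Q.ring.comap (algebraMap K L)
  const_mem c := by
    rw [ValuationSubring.mem_comap, ← IsScalarTower.algebraMap_apply]
    exact Q.const_mem c
  ne_top h := by
    apply Q.ne_top
    refine eq_top_iff.2 fun y _ => ?_
    have hy : IsIntegral K y := Algebra.IsIntegral.isIntegral y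
    have hK : ∀ z : K, algebraMap K L z ∈ Q.ring := fun z => by
      have : z ∈ Q.ring.comap (algebraMap K L) := by rw [h]; trivial
      exact this
    obtain ⟨p, hp, hpy⟩ := hy
    have hint : IsIntegral Q.ring y := by
      refine ⟨p.map ((algebraMap K L).codRestrict Q.ring.toSubring hK), hp.map _, ?_⟩
      rw [Polynomial.eval₂_map]
      exact hpy
    obtain ⟨z, hz⟩ := (IsIntegrallyClosed.isIntegral_iff (R := Q.ring) (K := L)).1 hint
    rw [← hz]
    exact z.2

section

variable {k : Type*} (K : Type*) {L : Type*} [Field k] [Field K] [Field L]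
    [Algebra k K] [Algebra k L] [Algebra K L] [IsScalarTower k K L] [Algebra.IsAlgebraic K L]

/-- The pull-back of germs of regular functions `𝒪_{π(Q)} → 𝒪_Q`, as an algebra structure. -/
noncomputable instance localAlgebra (Q : CurvePoint k L) : Algebra (Q.image K).ring Q.ring :=
  RingHom.toAlgebra
    (((algebraMap K L).comp (Q.image K).ring.subtype).codRestrict Q.ring.toSubring
      fun f => f.2)

/-- The ramification index of `Q` in the cover belonging to `L / K`. -/
noncomputable def ramIndex (Q : CurvePoint k L) : ℕ :=
  Ideal.ramificationIdx' (IsLocalRing.maximalIdeal (Q.image K).ring)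
    (IsLocalRing.maximalIdeal Q.ring)

/-- The coefficient of `Q` in the ramification divisor of the cover belonging to `L / K`, which is
the length of the stalk at `Q` of the sheaf of relative differentials. -/
noncomputable def ramCoeff (Q : CurvePoint k L) : ℕ∞ :=
  Module.length Q.ring (KaehlerDifferential (Q.image K).ring Q.ring)

end

section

variable {k K : Type*} (L : Type*) [Field k] [Field K] [Field L]
    [Algebra k K] [Algebra k L] [Algebra K L] [IsScalarTower k K L] [Algebra.IsAlgebraic K L]

/-- The set of points above `P` in the cover belonging to `L / K`. -/
def fiber (P : CurvePoint k K) : Set (CurvePoint k L) := {Q | Q.image K = P}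

/-- `P` is totally ramified: there is exactly one point above it, and the ramification index of
that point is the degree of the cover. -/
def IsTotallyRamified (P : CurvePoint k K) : Prop :=
  ∃ Q : CurvePoint k L, P.fiber L = {Q} ∧ Q.ramIndex K = Module.finrank K L

/-- `P` is unramified (for `k` algebraically closed): all points above it have ramification
index `1`. -/
def IsUnramified (P : CurvePoint k K) : Prop :=
  ∀ Q ∈ P.fiber L, Q.ramIndex K = 1

/-- The contribution of `P` to the ramification divisor: the degree of the part of the
ramification divisor that is supported above `P`. -/
noncomputable def ramContribution (P : CurvePoint k K) : ℕ∞ :=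
  ∑ᶠ Q ∈ P.fiber L, Q.ramCoeff K

end

end CurvePoint

/-! ## The tower -/

namespace ArtinSchreierTower

theorem exists_artinSchreier_root {Ω : Type*} [Field Ω] [IsAlgClosed Ω] (c : Ω) :
    ∃ y : Ω, y ^ 2 + y = c := by
  have hd : (Polynomial.X ^ 2 + Polynomial.X - Polynomial.C c : Polynomial Ω).degree ≠ 0 := by
    have : (Polynomial.X ^ 2 + Polynomial.X - Polynomial.C c : Polynomial Ω).degree = 2 := by
      compute_degree!
    rw [this]
    decide
  obtain ⟨y, hy⟩ := IsAlgClosed.exists_root _ hd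
  refine ⟨y, ?_⟩
  simp only [Polynomial.IsRoot.def, Polynomial.eval_sub, Polynomial.eval_add, Polynomial.eval_pow,
    Polynomial.eval_X, Polynomial.eval_C] at hy
  exact sub_eq_zero.1 hy

theorem coe_inclusion_algebraMap {k Ω : Type*} [Field k] [Field Ω] [Algebra k Ω]
    {E F : IntermediateField k Ω} (h : E ≤ F) (f : E) :
    (((IntermediateField.inclusion h).toRingHom.toAlgebra.algebraMap f : F) : Ω) = f := rfl

section

variable {Ω : Type*} [Field Ω] [IsAlgClosed Ω]

/-- The functions `x₀, x₁, x₂, …` of the tower over the line with coordinate `x₀`, inside an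
algebraically closed field `Ω` that contains `x₀`: here `x_{n+1}` is a root of
`Y² + Y = x_n + 1 + 1 / x_n`. -/
noncomputable def coord (x₀ : Ω) : ℕ → Ω
  | 0 => x₀
  | n + 1 => (exists_artinSchreier_root (coord x₀ n + 1 + 1 / coord x₀ n)).choose

theorem coord_succ (x₀ : Ω) (n : ℕ) :
    coord x₀ (n + 1) ^ 2 + coord x₀ (n + 1) = coord x₀ n + 1 + 1 / coord x₀ n := by
  rw [coord]
  exact (exists_artinSchreier_root (coord x₀ n + 1 + 1 / coord x₀ n)).choose_spec

variable (k : Type*) [Field k] [Algebra k Ω] (x₀ : Ω)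

/-- The function field `k(x₀, …, x_n)` of the curve `C_n`. -/
noncomputable def functionField (n : ℕ) : IntermediateField k Ω :=
  IntermediateField.adjoin k {y | ∃ m ≤ n, y = coord x₀ m}

theorem coord_mem {m n : ℕ} (h : m ≤ n) : coord x₀ m ∈ functionField k x₀ n :=
  IntermediateField.subset_adjoin _ _ ⟨m, h, rfl⟩

theorem functionField_le_succ (n : ℕ) : functionField k x₀ n ≤ functionField k x₀ (n + 1) :=
  IntermediateField.adjoin.mono _ _ _ fun _ ⟨m, hm, hy⟩ => ⟨m, by omega, hy⟩

/-- The function `x_m` on `C_n`, for `0 ≤ m ≤ n`. -/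
noncomputable def coordFun (n : ℕ) (m : Fin (n + 1)) : functionField k x₀ n :=
  ⟨coord x₀ m, coord_mem k x₀ (Nat.le_of_lt_succ m.2)⟩

/-- The pull-back of functions from `C_n` to `C_{n+1}`. -/
noncomputable instance stepAlgebra (n : ℕ) :
    Algebra (functionField k x₀ n) (functionField k x₀ (n + 1)) :=
  (IntermediateField.inclusion (functionField_le_succ k x₀ n)).toRingHom.toAlgebra

theorem coe_stepAlgebra (n : ℕ) (f : functionField k x₀ n) :
    ((algebraMap (functionField k x₀ n) (functionField k x₀ (n + 1)) f :
      functionField k x₀ (n + 1)) : Ω) = f :=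
  coe_inclusion_algebraMap (functionField_le_succ k x₀ n) f

instance stepScalarTower (n : ℕ) :
    IsScalarTower k (functionField k x₀ n) (functionField k x₀ (n + 1)) :=
  IsScalarTower.of_algebraMap_eq fun c =>
    Subtype.ext (coe_stepAlgebra k x₀ n (algebraMap k (functionField k x₀ n) c)).symm

instance stepScalarTower' (n : ℕ) :
    IsScalarTower (functionField k x₀ n) (functionField k x₀ (n + 1)) Ω :=
  IsScalarTower.of_algebraMap_eq fun f => (coe_stepAlgebra k x₀ n f).symm

instance stepAlgebraic (n : ℕ) :
    Algebra.IsAlgebraic (functionField k x₀ n) (functionField k x₀ (n + 1)) := by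
  have hle : functionField k x₀ (n + 1) ≤
      (algebraicClosure (functionField k x₀ n) Ω).restrictScalars k := by
    refine IntermediateField.adjoin_le_iff.2 ?_
    rintro _ ⟨m, hm, rfl⟩
    change coord x₀ m ∈ algebraicClosure (functionField k x₀ n) Ω
    rw [mem_algebraicClosure_iff]
    rcases Nat.lt_or_ge n m with h | h
    · obtain rfl : m = n + 1 := by omega
      let c : functionField k x₀ n := ⟨coord x₀ n, coord_mem k x₀ le_rfl⟩
      let p : Polynomial (functionField k x₀ n) :=
        Polynomial.X ^ 2 + Polynomial.X - Polynomial.C (c + 1 + 1 / c)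
      have hd : p.degree = 2 := by
        simp only [p]
        compute_degree!
      refine ⟨p, fun h0 => by simp [h0] at hd, ?_⟩
      have hv : algebraMap (functionField k x₀ n) Ω (c + 1 + 1 / c) =
        coord x₀ n + 1 + 1 / coord x₀ n := rfl
      simp only [p, map_sub, map_add, map_pow, Polynomial.aeval_X, Polynomial.aeval_C]
      rw [coord_succ, sub_eq_zero]
      simpa using hv.symm
    · exact isAlgebraic_algebraMap (⟨coord x₀ m, coord_mem k x₀ h⟩ : functionField k x₀ n)
  refine ⟨fun y => ?_⟩
  have hy : IsAlgebraic (functionField k x₀ n)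
      (algebraMap (functionField k x₀ (n + 1)) Ω y) := mem_algebraicClosure_iff.1 (hle y.2)
  exact (isAlgebraic_algebraMap_iff (algebraMap (functionField k x₀ (n + 1)) Ω).injective).1 hy

/-- The points of the curve `C_n` (over `k`). -/
abbrev Point (n : ℕ) : Type _ := CurvePoint k (functionField k x₀ n)

variable {k x₀}

/-- `P` is a point `P(a₀, …, a_n)` of `C_n`: one has `x_m(P) = a_m` for `0 ≤ m ≤ n`. -/
def HasIndexSequence {n : ℕ} (P : Point k x₀ n) (a : Fin (n + 1) → OnePoint k) : Prop :=
  ∀ m : Fin (n + 1), P.HasValue (coordFun k x₀ n m) (a m)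

end

/-- The index sequence `(a₀, …, a_{i-1}, 0, ∞, …, ∞)` with `j` entries `∞` at the end. -/
noncomputable def poleSequence {k : Type*} [Field k] {i : ℕ} (j : ℕ) (a : Fin i → OnePoint k) :
    Fin (i + j + 1) → OnePoint k := fun m =>
  if h : (m : ℕ) < i then a ⟨m, h⟩
  else if (m : ℕ) = i then ((0 : k) : OnePoint k)
  else OnePoint.infty

end ArtinSchreierTower

/-! Write ℘(g) = g² + g and let u = x_n + 1 + 1/x_n. Replacing the root y by y + g replaces u by u +
℘(g), so only the class of u modulo all ℘(g) matters. If a representative is regular at P, then P is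
unramified (`isUnramified_of_artinSchreier`). If one has a simple pole, then P is totally ramified
and contributes 2 (`isTotallyRamified_of_artinSchreier`). It remains to find g at each level.

Fix a valuation of Ω extending the local ring of P. For 2l < i the function x_{2l} takes the value 1
and x_{2l+1} a primitive cube root of unity. Hence i = 2m, the tower is unramified up to level i,
and x_0 + 1 is still a uniformizer there. Put s_l = x_{2l} + 1 for l < m, s_m = x_{2m}, W_l =
x_{2l+1} + 1, and let ≡ mean equality up to regular functions. Then 1/s_{l+1} ≡ 1/s_l + ℘(W_l/s_l)
(`inv_reduction`), which moves the pole of u from 1/x_{2m} to 1/s_0, a simple pole.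

Above level i two states alternate, with an index q that starts at 0. In `EvenStage`, u ≡ A_m and
A_{l+1} ≡ A_l + ℘(W_l A_l) for q ≤ l < m, and A_q has a simple pole; so the next step ramifies, and
H_l = y + ∑_{l ≤ r < m} W_r A_r satisfies ℘(H_l) ≡ A_l. Since W_l² + W_l + 1 is a regular multiple
of s_l² and s_l H_l is regular, this gives H_{l+1} ≡ ℘((W_l + 1) H_l), which is `OddStage`. There u
≡ H_m is itself a ℘ if q < m, so the next step is unramified, and A_{l+1} = (W_l + 1) H_l restores
`EvenStage` with q + 1. At q = m, that is at level 2i, the last coordinate itself has a simple pole,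
and every later step ramifies. -/

namespace Valuation

/-! ### Quadratic Artin-Schreier extensions of discretely valued fields -/

variable {Ω Γ : Type*} [Field Ω] [LinearOrderedCommGroupWithZero Γ] (v : Valuation Ω Γ)

theorem map_sq_add_self_of_one_lt {y : Ω} (h : 1 < v y) : v (y ^ 2 + y) = v y ^ 2 := by
  have hlt : v y < v (y ^ 2) := by
    rw [map_pow, sq]
    exact lt_mul_of_one_lt_left (zero_lt_one.trans h) h
  rw [v.map_add_eq_of_lt_left hlt, map_pow]

theorem map_sq_add_self_le_one_iff {y : Ω} : v (y ^ 2 + y) ≤ 1 ↔ v y ≤ 1 := by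
  refine ⟨fun h => ?_, fun h => v.map_add_le ?_ h⟩
  · by_contra! hy
    rw [v.map_sq_add_self_of_one_lt hy] at h
    exact absurd (one_lt_pow₀ hy two_ne_zero) h.not_gt
  · rw [map_pow]
    exact pow_le_one₀ zero_le h

/-- The element `π` generates the value group of the restriction of `v` to the subfield `E`. -/
structure IsUniformizerOn (E : Subfield Ω) (π : Ω) : Prop where
  mem : π ∈ E
  ne_zero : π ≠ 0
  lt_one : v π < 1
  exists_zpow : ∀ f ∈ E, f ≠ 0 → ∃ n : ℤ, v f = v π ^ n

variable {v}

theorem IsUniformizerOn.map {K Γ' : Type*} [Field K] [LinearOrderedCommGroupWithZero Γ']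
    {w : Valuation K Γ'} {φ : K →+* Ω} (h : w.IsEquiv (v.comap φ)) {π : K} :
    v.IsUniformizerOn φ.fieldRange (φ π) ↔ w.IsUniformizerOn ⊤ π := by
  have hz : ∀ (f : K) (n : ℤ), v (φ f) = v (φ π) ^ n ↔ w f = w π ^ n := fun f n => by
    have := h.eq_iff (r := f) (s := π ^ n)
    simpa using this.symm
  constructor
  · rintro ⟨-, h0, h1, h2⟩
    refine ⟨trivial, by simpa using h0, h.lt_one_iff_lt_one.2 h1, fun f _ hf => ?_⟩
    obtain ⟨n, hn⟩ := h2 (φ f) ⟨f, rfl⟩ (by simpa using hf)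
    exact ⟨n, (hz f n).1 hn⟩
  · rintro ⟨-, h0, h1, h2⟩
    refine ⟨⟨π, rfl⟩, by simpa using h0, h.lt_one_iff_lt_one.1 h1, ?_⟩
    rintro _ ⟨f, rfl⟩ hf
    obtain ⟨n, hn⟩ := h2 f trivial (by simpa using hf)
    exact ⟨n, (hz f n).2 hn⟩

/-- An Artin-Schreier extension of a discretely valued field by a root of `Y ^ 2 + Y = u` with
`u` integral is unramified. -/
theorem IsUniformizerOn.of_integral [CharP Ω 2] {E E' : Subfield Ω} {π y : Ω}
    (h : v.IsUniformizerOn E π) (hE : E ≤ E')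
    (hspan : ∀ f ∈ E', ∃ a ∈ E, ∃ b ∈ E, f = a + b * y)
    (hyE : y ^ 2 + y ∈ E) (hy : v (y ^ 2 + y) ≤ 1) : v.IsUniformizerOn E' π := by
  rw [map_sq_add_self_le_one_iff] at hy
  -- For primitive coefficients, a non-unit a + b y forces b to be a unit. Then the conjugate a + b
  -- y + b is a unit, so a + b y has the same value as its norm, which lies in E.
  have key : ∀ a ∈ E, ∀ b ∈ E, v a ≤ 1 → v b ≤ 1 → (v a = 1 ∨ v b = 1) → a + b * y ≠ 0 →
      ∃ n : ℤ, v (a + b * y) = v π ^ n := by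
    intro a ha b hb hva hvb hab h0
    have hby : v (b * y) ≤ 1 := by
      rw [map_mul]
      exact mul_le_one' hvb hy
    rcases (v.map_add_le hva hby).eq_or_lt with h1 | h1
    · exact ⟨0, by rw [h1, zpow_zero]⟩
    have hb1 : v b = 1 := by
      by_contra hb1
      have ha1 := hab.resolve_right hb1
      have hby1 : v (b * y) < v a := by
        rw [map_mul, ha1]
        exact (mul_le_of_le_one_right' hy).trans_lt (lt_of_le_of_ne hvb hb1)
      rw [v.map_add_eq_of_lt_left hby1, ha1] at h1
      exact lt_irrefl _ h1
    have hc : v (a + b * y + b) = 1 := by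
      rw [v.map_add_eq_of_lt_right (by rwa [hb1]), hb1]
    have hN : (a + b * y) * (a + b * y + b) = a ^ 2 + a * b + b ^ 2 * (y ^ 2 + y) := by
      linear_combination (a * b * y) * CharTwo.two_eq_zero (R := Ω)
    have hNE : a ^ 2 + a * b + b ^ 2 * (y ^ 2 + y) ∈ E :=
      add_mem (add_mem (pow_mem ha 2) (mul_mem ha hb)) (mul_mem (pow_mem hb 2) hyE)
    have hN0 : a ^ 2 + a * b + b ^ 2 * (y ^ 2 + y) ≠ 0 := by
      rw [← hN]
      refine mul_ne_zero h0 fun h => ?_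
      rw [h, map_zero] at hc
      exact zero_ne_one hc
    obtain ⟨n, hn⟩ := h.exists_zpow _ hNE hN0
    exact ⟨n, by rw [← hn, ← hN, map_mul, hc, mul_one]⟩
  have scale : ∀ c ∈ E, c ≠ 0 → ∀ a ∈ E, ∀ b ∈ E, v a ≤ v c → v b ≤ v c →
      (v a = v c ∨ v b = v c) → a + b * y ≠ 0 → ∃ n : ℤ, v (a + b * y) = v π ^ n := by
    intro c hc hc0 a ha b hb hac hbc hab h0
    have hvc : v c ≠ 0 := by simpa using hc0
    have he : a + b * y = c * (a / c + b / c * y) := by field_simp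
    obtain ⟨n, hn⟩ := key (a / c) (div_mem ha hc) (b / c) (div_mem hb hc)
      (by rw [map_div₀]; exact div_le_one_of_le₀ hac zero_le)
      (by rw [map_div₀]; exact div_le_one_of_le₀ hbc zero_le)
      (by simpa [map_div₀, div_eq_one_iff_eq hvc] using hab)
      (fun h => h0 (by rw [he, h, mul_zero]))
    obtain ⟨m, hm⟩ := h.exists_zpow c hc hc0
    refine ⟨m + n, ?_⟩
    rw [he, map_mul, hn, hm, zpow_add₀ (by simpa using h.ne_zero)]
  refine ⟨hE h.mem, h.ne_zero, h.lt_one, fun f hf h0 => ?_⟩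
  obtain ⟨a, ha, b, hb, rfl⟩ := hspan f hf
  rcases le_total (v a) (v b) with hab | hab
  · refine scale b hb ?_ a ha b hb hab le_rfl (Or.inr rfl) h0
    rintro rfl
    have : a = 0 := by simpa using hab
    simp [this] at h0
  · refine scale a ha ?_ a ha b hb le_rfl hab (Or.inl rfl) h0
    rintro rfl
    have : b = 0 := by simpa using hab
    simp [this] at h0

/-- The value of a root of `Y ^ 2 + Y = u` with `u` of order `-1`. -/
theorem IsUniformizerOn.one_lt_root {E : Subfield Ω} {π y : Ω} (h : v.IsUniformizerOn E π)
    (hy : v (y ^ 2 + y) * v π = 1) : 1 < v y := by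
  by_contra! hy1
  have := mul_le_of_le_one_left' (a := v π) (v.map_sq_add_self_le_one_iff.2 hy1)
  rw [hy] at this
  exact h.lt_one.not_ge this

theorem IsUniformizerOn.map_eq_root_zpow {E : Subfield Ω} {π y : Ω} (h : v.IsUniformizerOn E π)
    (hy : v (y ^ 2 + y) * v π = 1) : v π = v y ^ (-2 : ℤ) := by
  have h1 := h.one_lt_root hy
  rw [map_sq_add_self_of_one_lt v h1] at hy
  rw [zpow_neg, zpow_ofNat]
  exact eq_inv_of_mul_eq_one_right hy

/-- Because v π = v y ^ (-2), nonzero elements of E have even exponent with respect to v y, and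
their multiples by y⁻¹ have odd exponent. This parity keeps the two summands of a + b y⁻¹ from
cancelling. -/
theorem IsUniformizerOn.exists_root_zpow {E : Subfield Ω} {π y : Ω} (h : v.IsUniformizerOn E π)
    (hy : v (y ^ 2 + y) * v π = 1) {a : Ω} (ha : a ∈ E) (ha0 : a ≠ 0) :
    ∃ n : ℤ, v a = v y ^ (2 * n) := by
  obtain ⟨n, hn⟩ := h.exists_zpow a ha ha0
  refine ⟨-n, ?_⟩
  rw [hn, h.map_eq_root_zpow hy, ← zpow_mul]
  congr 1
  ring

theorem IsUniformizerOn.exists_mul_inv_root_zpow {E : Subfield Ω} {π y : Ω}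
    (h : v.IsUniformizerOn E π) (hy : v (y ^ 2 + y) * v π = 1) {b : Ω} (hb : b ∈ E)
    (hb0 : b ≠ 0) : ∃ n : ℤ, v b = v y ^ (2 * n) ∧ v (b * y⁻¹) = v y ^ (2 * n - 1) := by
  obtain ⟨n, hn⟩ := h.exists_root_zpow hy hb hb0
  have h0 : v y ≠ 0 := (zero_lt_one.trans (h.one_lt_root hy)).ne'
  exact ⟨n, hn, by rw [map_mul, hn, map_inv₀, zpow_sub_one₀ h0]⟩

/-- In a ramified Artin-Schreier extension `E (y)` of `E`, the elements `1` and `y⁻¹` are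
orthogonal. -/
theorem IsUniformizerOn.map_add_mul_inv_root {E : Subfield Ω} {π y : Ω}
    (h : v.IsUniformizerOn E π) (hy : v (y ^ 2 + y) * v π = 1) {a b : Ω} (ha : a ∈ E)
    (hb : b ∈ E) : v (a + b * y⁻¹) = max (v a) (v (b * y⁻¹)) := by
  rcases eq_or_ne a 0 with rfl | ha0
  · simp
  rcases eq_or_ne b 0 with rfl | hb0
  · simp
  refine v.map_add_of_distinct_val ?_
  obtain ⟨n, hn⟩ := h.exists_root_zpow hy ha ha0
  obtain ⟨m, -, hm⟩ := h.exists_mul_inv_root_zpow hy hb hb0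
  have h1 := h.one_lt_root hy
  rw [hn, hm]
  intro he
  have := zpow_right_injective₀ (zero_lt_one.trans h1) h1.ne' he
  omega

/-- Orthogonality reduces this to b y⁻¹, where 2m - 1 ≤ 0 and 2m ≤ 0 are the same condition on an
integer m. The integers upstairs are therefore free over those of E on 1 and y⁻¹. -/
theorem IsUniformizerOn.map_add_mul_inv_root_le_one {E : Subfield Ω} {π y : Ω}
    (h : v.IsUniformizerOn E π) (hy : v (y ^ 2 + y) * v π = 1) {a b : Ω} (ha : a ∈ E)
    (hb : b ∈ E) : v (a + b * y⁻¹) ≤ 1 ↔ v a ≤ 1 ∧ v b ≤ 1 := by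
  rw [h.map_add_mul_inv_root hy ha hb, max_le_iff, and_congr_right_iff]
  intro _
  rcases eq_or_ne b 0 with rfl | hb0
  · simp
  obtain ⟨m, hm', hm⟩ := h.exists_mul_inv_root_zpow hy hb hb0
  have h1 := h.one_lt_root hy
  rw [hm, hm', ← zpow_zero (v y), zpow_le_zpow_iff_right₀ h1, zpow_le_zpow_iff_right₀ h1]
  omega

theorem _root_.Subfield.exists_eq_add_mul_inv {E : Subfield Ω} {y f : Ω} (hy0 : y ≠ 0)
    (hyE : y ^ 2 + y ∈ E) (hf : ∃ a ∈ E, ∃ b ∈ E, f = a + b * y) :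
    ∃ a ∈ E, ∃ b ∈ E, f = a + b * y⁻¹ := by
  obtain ⟨a, ha, b, hb, rfl⟩ := hf
  refine ⟨a - b, sub_mem ha hb, b * (y ^ 2 + y), mul_mem hb hyE, ?_⟩
  field_simp
  ring

theorem IsUniformizerOn.root_ne_zero {E : Subfield Ω} {π y : Ω} (h : v.IsUniformizerOn E π)
    (hy : v (y ^ 2 + y) * v π = 1) : y ≠ 0 :=
  v.ne_zero_iff.1 (zero_lt_one.trans (h.one_lt_root hy)).ne'

theorem IsUniformizerOn.root_notMem {E : Subfield Ω} {π y : Ω} (h : v.IsUniformizerOn E π)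
    (hy : v (y ^ 2 + y) * v π = 1) : y ∉ E := fun hyE => by
  -- If y were in E, orthogonality could be applied to y⁻¹ + (-1) y⁻¹ = 0, giving y⁻¹ = 0.
  have := h.map_add_mul_inv_root hy (inv_mem hyE) (neg_mem (one_mem E))
  exact h.root_ne_zero hy (by simpa using this.symm)

/-- An Artin-Schreier extension of a discretely valued field by a root `y` of `Y ^ 2 + Y = u` with
`u` of order `-1` is ramified, and `y⁻¹` is a uniformizer. -/
theorem IsUniformizerOn.of_simple_pole {E E' : Subfield Ω} {π y : Ω}
    (h : v.IsUniformizerOn E π) (hyE' : y ∈ E') (hspan : ∀ f ∈ E', ∃ a ∈ E, ∃ b ∈ E, f = a + b * y)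
    (hyE : y ^ 2 + y ∈ E) (hy : v (y ^ 2 + y) * v π = 1) : v.IsUniformizerOn E' y⁻¹ := by
  have h1 := h.one_lt_root hy
  have hy0 := h.root_ne_zero hy
  refine ⟨inv_mem hyE', inv_ne_zero hy0, ?_, fun f hf h0 => ?_⟩
  · rw [map_inv₀]
    exact inv_lt_one_of_one_lt₀ h1
  obtain ⟨a, ha, b, hb, rfl⟩ := Subfield.exists_eq_add_mul_inv hy0 hyE (hspan f hf)
  have hz : ∀ x : Ω, (∃ n : ℤ, v x = v y ^ n) → ∃ n : ℤ, v x = v y⁻¹ ^ n := by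
    rintro x ⟨n, hn⟩
    exact ⟨-n, by rw [hn, map_inv₀, inv_zpow', neg_neg]⟩
  apply hz
  rw [h.map_add_mul_inv_root hy ha hb]
  rcases eq_or_ne a 0 with rfl | ha0
  · obtain ⟨m, -, hm⟩ := h.exists_mul_inv_root_zpow hy hb (by rintro rfl; simp at h0)
    exact ⟨_, by simpa using hm⟩
  obtain ⟨n, hn⟩ := h.exists_root_zpow hy ha ha0
  rcases eq_or_ne b 0 with rfl | hb0
  · exact ⟨_, by simpa using hn⟩
  obtain ⟨m, -, hm⟩ := h.exists_mul_inv_root_zpow hy hb hb0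
  rcases max_choice (v a) (v (b * y⁻¹)) with hc | hc <;> rw [hc]
  exacts [⟨_, hn⟩, ⟨_, hm⟩]

end Valuation

/-! ### Differentials of a quadratic extension -/

open IsLocalRing

/-- The Kähler differentials of a monogenic quadratic extension of rings of characteristic two. -/
theorem KaehlerDifferential.nonempty_equiv_of_quadratic {R S : Type*} [CommRing R] [CommRing S]
    [Algebra R S] [CharP S 2] (c : R) (t : S)
    (ht : t ^ 2 = algebraMap R S c + algebraMap R S c * t)
    (hbij : Function.Bijective fun p : R × R => algebraMap R S p.1 + algebraMap R S p.2 * t) :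
    Nonempty ((S ⧸ Ideal.span {algebraMap R S c}) ≃ₗ[S] KaehlerDifferential R S) := by
  let I := Ideal.span {algebraMap R S c}
  let φ : (R × R) →ₗ[R] S :=
    { toFun := fun p => algebraMap R S p.1 + algebraMap R S p.2 * t
      map_add' := fun p q => by simp only [Prod.fst_add, Prod.snd_add, map_add]; ring
      map_smul' := fun r p => by
        simp only [Prod.smul_fst, Prod.smul_snd, smul_eq_mul, map_mul, RingHom.id_apply]
        rw [Algebra.smul_def]
        ring }
  let e : (R × R) ≃ₗ[R] S := LinearEquiv.ofBijective φ hbij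
  let β : S →ₗ[R] R := LinearMap.snd R R R ∘ₗ e.symm.toLinearMap
  have hβ : ∀ a b : R, β (algebraMap R S a + algebraMap R S b * t) = b := fun a b => by
    have : e.symm (algebraMap R S a + algebraMap R S b * t) = (a, b) := by
      rw [LinearEquiv.symm_apply_eq]; rfl
    simp [β, this]
  let D₀ : S →ₗ[R] S ⧸ I := (Submodule.mkQ I).restrictScalars R ∘ₗ Algebra.linearMap R S ∘ₗ β
  have hD₀ : ∀ a b : R, D₀ (algebraMap R S a + algebraMap R S b * t) =
      Ideal.Quotient.mk I (algebraMap R S b) := fun a b => by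
    simp only [D₀, LinearMap.comp_apply, hβ]; rfl
  have h2 : (2 : S) = 0 := CharTwo.two_eq_zero
  -- The inverse map comes from the derivation a + b t ↦ b mod c. The Leibniz rule fails in S only
  -- by b b' (c - 2t), which lies in (c) in characteristic two.
  let D : Derivation R S (S ⧸ I) := Derivation.mk' D₀ fun f g => by
    obtain ⟨⟨a, b⟩, rfl⟩ := hbij.2 f
    obtain ⟨⟨a', b'⟩, rfl⟩ := hbij.2 g
    have hm : (algebraMap R S a + algebraMap R S b * t) *
        (algebraMap R S a' + algebraMap R S b' * t) = algebraMap R S (a * a' + b * b' * c) +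
          algebraMap R S (a * b' + a' * b + b * b' * c) * t := by
      simp only [map_add, map_mul]
      linear_combination (algebraMap R S b * algebraMap R S b') * ht
    simp only [hm, hD₀, Algebra.smul_def]
    change _ = Ideal.Quotient.mk I _ * Ideal.Quotient.mk I _ +
      Ideal.Quotient.mk I _ * Ideal.Quotient.mk I _
    rw [← map_mul, ← map_mul, ← map_add, Ideal.Quotient.eq, Ideal.mem_span_singleton']
    refine ⟨algebraMap R S b * algebraMap R S b', ?_⟩
    simp only [map_add, map_mul]
    linear_combination (algebraMap R S b * algebraMap R S b' * t) * h2
  have hDt : D t = Ideal.Quotient.mk I 1 := by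
    have := hD₀ 0 1
    rwa [map_zero, map_one, one_mul, zero_add] at this
  -- Differentiating t² = c + c t gives 2t dt = c dt, so c kills dt and 1 ↦ dt is well defined on
  -- S/(c).
  let ψ : (S ⧸ I) →ₗ[S] KaehlerDifferential R S :=
    Submodule.liftQ I (LinearMap.toSpanSingleton S _ (KaehlerDifferential.D R S t)) (by
      refine (Ideal.span_singleton_le_iff_mem _).2 ?_
      have := congrArg (KaehlerDifferential.D R S) ht
      simp only [Derivation.leibniz_pow, map_add, Derivation.map_algebraMap, Derivation.leibniz,
        smul_zero, add_zero, zero_add] at this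
      rw [LinearMap.mem_ker, LinearMap.toSpanSingleton_apply, ← this, ← Nat.cast_smul_eq_nsmul S]
      simp [h2])
  have hψ1 : ψ (Ideal.Quotient.mk I 1) = KaehlerDifferential.D R S t := by
    change LinearMap.toSpanSingleton S _ (KaehlerDifferential.D R S t) 1 = _
    simp
  have hmk : ∀ s : S, Ideal.Quotient.mk I s = s • Ideal.Quotient.mk I 1 := fun s => by
    rw [Algebra.smul_def, map_one, mul_one]; rfl
  refine ⟨LinearEquiv.ofLinearMap ψ D.liftKaehlerDifferential ?_ ?_⟩
  · apply KaehlerDifferential.linearMapEquivDerivation R S |>.injective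
    ext f
    obtain ⟨⟨a, b⟩, rfl⟩ := hbij.2 f
    rw [map_one] at hψ1
    simp [Derivation.liftKaehlerDifferential_comp_D, hψ1, hDt]
  · refine LinearMap.ext fun x => ?_
    obtain ⟨s, rfl⟩ := Ideal.Quotient.mk_surjective x
    simp only [LinearMap.comp_apply, LinearMap.id_apply]
    rw [hmk, map_smul, map_smul, hψ1, Derivation.liftKaehlerDifferential_comp_D, hDt]

/-! ### Uniformizers, lengths and extension of valuation rings -/

namespace ValuationSubring

variable {K L : Type*} [Field K] [Field L]

theorem dvd_iff_valuation_le (V : ValuationSubring K) {a b : V} :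
    a ∣ b ↔ V.valuation (b : K) ≤ V.valuation (a : K) := by
  rw [V.valuation_le_iff]
  constructor
  · rintro ⟨c, rfl⟩
    exact ⟨c, by push_cast; ring⟩
  · rintro ⟨c, hc⟩
    exact ⟨c, Subtype.ext (by push_cast; rw [← hc]; ring)⟩

theorem maximalIdeal_eq_span {V : ValuationSubring K} {π : V}
    (h : V.valuation.IsUniformizerOn ⊤ (π : K)) : maximalIdeal V = Ideal.span {π} := by
  ext f
  rw [Ideal.mem_span_singleton, V.dvd_iff_valuation_le, V.valuation_lt_one_iff]
  refine ⟨fun hf => ?_, fun hf => hf.trans_lt h.lt_one⟩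
  rcases eq_or_ne (f : K) 0 with h0 | h0
  · simp [h0]
  obtain ⟨n, hn⟩ := h.exists_zpow f trivial h0
  have hpos : 0 < V.valuation (π : K) := V.valuation.pos_iff.2 h.ne_zero
  rw [hn, ← zpow_zero (V.valuation (π : K)), zpow_lt_zpow_iff_right_of_lt_one₀ hpos h.lt_one] at hf
  rw [hn]
  calc _ ≤ V.valuation (π : K) ^ (1 : ℤ) :=
        (zpow_le_zpow_iff_right_of_lt_one₀ hpos h.lt_one).2 (by omega)
    _ = _ := zpow_one _

theorem length_quotient_uniformizer_pow {V : ValuationSubring K} {π : V}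
    (h : V.valuation.IsUniformizerOn ⊤ (π : K)) (n : ℕ) :
    Module.length V (V ⧸ Ideal.span {π ^ n}) = n := by
  have hπ : π ∈ nonZeroDivisors V :=
    mem_nonZeroDivisors_of_ne_zero fun h0 => h.ne_zero (by simp [h0])
  have h1 : Ring.ord V π = 1 := by
    rw [Ring.ord, Module.length_eq_one_iff, ← maximalIdeal_eq_span h,
      isSimpleModule_iff_isSimpleModule_of_algebraMap_surjective (S := V ⧸ maximalIdeal V)
        Ideal.Quotient.mk_surjective]
    let := Ideal.Quotient.field (maximalIdeal V)
    exact instIsSimpleModule _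
  have := Ring.ord_pow hπ n
  rw [h1] at this
  simpa [Ring.ord] using this

/-- Valuation rings extend along field extensions. -/
theorem exists_comap_eq (φ : K →+* L) (A : ValuationSubring K) :
    ∃ B : ValuationSubring L, B.comap φ = A := by
  obtain ⟨B, hB, hloc⟩ := IsLocalRing.exists_factor_valuationRing (φ.comp A.subtype)
  refine ⟨B, ValuationSubring.ext _ _ fun x => ?_⟩
  rw [ValuationSubring.mem_comap]
  refine ⟨fun hx => ?_, fun hx => hB ⟨x, hx⟩⟩
  rcases A.mem_or_inv_mem x with h | h
  · exact h
  rcases eq_or_ne x 0 with rfl | h0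
  · exact A.zero_mem
  -- If φ x is in B but only x⁻¹ is known to be in A, then x⁻¹ becomes a unit in B. The map A → B is
  -- local, so x⁻¹ is already a unit in A.
  have hu : IsUnit (((φ.comp A.subtype).codRestrict B.toSubring hB) ⟨x⁻¹, h⟩) :=
    IsUnit.of_mul_eq_one (⟨φ x, hx⟩ : B.toSubring) (Subtype.ext (by
      change φ x⁻¹ * φ x = 1
      rw [← map_mul, inv_mul_cancel₀ h0, map_one]))
  obtain ⟨c, hc⟩ := (isUnit_of_map_unit _ _ hu).exists_right_inv
  have hc' : x⁻¹ * (c : K) = 1 := congrArg Subtype.val hc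
  have : x = c := by
    field_simp at hc'
    exact hc'.symm
  rw [this]
  exact c.2

theorem isEquiv_comap_of_comap_eq {φ : K →+* L} {A : ValuationSubring K} {B : ValuationSubring L}
    (h : B.comap φ = A) : A.valuation.IsEquiv (B.valuation.comap φ) := by
  rw [Valuation.isEquiv_iff_val_le_one]
  intro x
  rw [Valuation.comap_apply, valuation_le_one_iff, valuation_le_one_iff, ← h, mem_comap]

end ValuationSubring

/-! ### Ramification of Artin-Schreier covers of curves -/

namespace CurvePoint

theorem exists_eq_add_mul_inv {K L : Type*} [Field K] [Field L] [Algebra K L] {u : K} {y : L}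
    (hy0 : y ≠ 0)
    (hy : y ^ 2 + y = algebraMap K L u)
    (hspan : ∀ f : L, ∃ a b : K, f = algebraMap K L a + algebraMap K L b * y) (f : L) :
    ∃ a b : K, f = algebraMap K L a + algebraMap K L b * y⁻¹ := by
  have hf : ∃ a ∈ (algebraMap K L).fieldRange, ∃ b ∈ (algebraMap K L).fieldRange,
      f = a + b * y := by
    obtain ⟨a, b, rfl⟩ := hspan f
    exact ⟨_, ⟨a, rfl⟩, _, ⟨b, rfl⟩, rfl⟩
  obtain ⟨_, ⟨a, rfl⟩, _, ⟨b, rfl⟩, rfl⟩ := Subfield.exists_eq_add_mul_inv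
    (E := (algebraMap K L).fieldRange) hy0 ⟨u, hy.symm⟩ hf
  exact ⟨a, b, rfl⟩

section

variable {k K L : Type*} [Field k] [Field K] [Field L] [Algebra k K] [Algebra k L] [Algebra K L]
  [IsScalarTower k K L] [Algebra.IsAlgebraic K L]

theorem isEquiv_image_valuation (Q : CurvePoint k L) :
    (Q.image K).ring.valuation.IsEquiv (Q.ring.valuation.comap (algebraMap K L)) :=
  ValuationSubring.isEquiv_comap_of_comap_eq rfl

theorem coe_localAlgebra_algebraMap (Q : CurvePoint k L) (f : (Q.image K).ring) :
    ((algebraMap (Q.image K).ring Q.ring f : Q.ring) : L) = algebraMap K L f := rfl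

theorem isUniformizerOn_fieldRange {Q : CurvePoint k L} {π : K}
    (h : (Q.image K).ring.valuation.IsUniformizerOn ⊤ π) :
    Q.ring.valuation.IsUniformizerOn (algebraMap K L).fieldRange (algebraMap K L π) :=
  (Valuation.IsUniformizerOn.map (Q.isEquiv_image_valuation (K := K))).2 h

theorem ramIndex_eq {Q : CurvePoint k L} {π : K} {ϖ : L} {e : ℕ}
    (hπ : (Q.image K).ring.valuation.IsUniformizerOn ⊤ π)
    (hϖ : Q.ring.valuation.IsUniformizerOn ⊤ ϖ)
    (he : Q.ring.valuation (algebraMap K L π) = Q.ring.valuation ϖ ^ e) : Q.ramIndex K = e := by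
  lift π to (Q.image K).ring using
    ((Q.image K).ring.valuation_le_one_iff _).1 hπ.lt_one.le
  lift ϖ to Q.ring using (Q.ring.valuation_le_one_iff _).1 hϖ.lt_one.le
  rw [ramIndex, ValuationSubring.maximalIdeal_eq_span hπ, ValuationSubring.maximalIdeal_eq_span hϖ]
  have hle : ∀ n : ℕ, Ideal.map (algebraMap (Q.image K).ring Q.ring) (Ideal.span {π}) ≤
      Ideal.span {ϖ} ^ n ↔ Q.ring.valuation (ϖ : L) ^ e ≤ Q.ring.valuation (ϖ : L) ^ n := by
    intro n
    rw [Ideal.map_span, Set.image_singleton, Ideal.span_singleton_pow,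
      Ideal.span_singleton_le_span_singleton, ValuationSubring.dvd_iff_valuation_le,
      coe_localAlgebra_algebraMap, he]
    simp
  refine Ideal.ramificationIdx'_spec ((hle e).2 le_rfl) fun h => ?_
  rw [hle, pow_succ] at h
  refine h.not_gt (mul_lt_of_lt_one_right (pow_pos ?_ e) hϖ.lt_one)
  exact Q.ring.valuation.pos_iff.2 hϖ.ne_zero

/-- An Artin-Schreier cover `Y ^ 2 + Y = u` is unramified over the points at which `u` is regular,
up to adding a function `g ^ 2 + g`. -/
theorem isUnramified_of_artinSchreier [CharP L 2] {P : CurvePoint k K} {π : K} {y : L}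
    (hπ : P.ring.valuation.IsUniformizerOn ⊤ π) (u : K) (hu : P.ring.valuation u ≤ 1)
    (hy : y ^ 2 + y = algebraMap K L u)
    (hspan : ∀ f : L, ∃ a b : K, f = algebraMap K L a + algebraMap K L b * y) :
    P.IsUnramified L := by
  rintro Q rfl
  have hE := isUniformizerOn_fieldRange hπ
  refine ramIndex_eq hπ (hE.of_integral (y := y) le_top (fun f _ => ?_) ⟨u, hy.symm⟩ ?_)
    (pow_one _).symm
  · obtain ⟨a, b, rfl⟩ := hspan f
    exact ⟨_, ⟨a, rfl⟩, _, ⟨b, rfl⟩, rfl⟩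
  · rw [hy]
    exact (Q.isEquiv_image_valuation (K := K)).le_one_iff_le_one.1 hu

/-- A valuation ring of a field extension above the local ring of a point `P` belongs to a point
above `P`. -/
theorem fiber_nonempty (P : CurvePoint k K) : (P.fiber L).Nonempty := by
  obtain ⟨B, hB⟩ := ValuationSubring.exists_comap_eq (algebraMap K L) P.ring
  refine ⟨⟨B, fun c => ?_, ?_⟩, ?_⟩
  · rw [IsScalarTower.algebraMap_apply k K L, ← ValuationSubring.mem_comap, hB]
    exact P.const_mem c
  · rintro rfl
    exact P.ne_top (hB.symm.trans (by ext; simp))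
  · cases P
    simp only [fiber, image, Set.mem_ofPred_eq]
    congr

section SimplePole

theorem map_artinSchreier_mul_eq_one {Q : CurvePoint k L} {π u : K} {y : L}
    (hu : (Q.image K).ring.valuation u * (Q.image K).ring.valuation π = 1)
    (hy : y ^ 2 + y = algebraMap K L u) :
    Q.ring.valuation (y ^ 2 + y) * Q.ring.valuation (algebraMap K L π) = 1 := by
  rw [← map_mul] at hu
  rw [hy, ← map_mul, ← map_mul]
  exact (Q.isEquiv_image_valuation (K := K)).eq_one_iff_eq_one.1 hu

/-- The local ring at Q is 𝒪 ⊕ 𝒪 y⁻¹ with 𝒪 the local ring below. This yields both the uniqueness of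
the point in the fiber and the monogenic presentation needed for the differentials. -/
theorem mem_ring_iff_of_simple_pole {Q : CurvePoint k L} {π u : K} {y : L}
    (hπ : (Q.image K).ring.valuation.IsUniformizerOn ⊤ π)
    (hu : (Q.image K).ring.valuation u * (Q.image K).ring.valuation π = 1)
    (hy : y ^ 2 + y = algebraMap K L u) (a b : K) :
    algebraMap K L a + algebraMap K L b * y⁻¹ ∈ Q.ring ↔
      a ∈ (Q.image K).ring ∧ b ∈ (Q.image K).ring := by
  rw [← ValuationSubring.valuation_le_one_iff,
    (isUniformizerOn_fieldRange hπ).map_add_mul_inv_root_le_one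
      (map_artinSchreier_mul_eq_one hu hy) ⟨a, rfl⟩ ⟨b, rfl⟩,
    ValuationSubring.valuation_le_one_iff, ValuationSubring.valuation_le_one_iff]
  rfl

theorem root_notMem_fieldRange {Q : CurvePoint k L} {π u : K} {y : L}
    (hπ : (Q.image K).ring.valuation.IsUniformizerOn ⊤ π)
    (hu : (Q.image K).ring.valuation u * (Q.image K).ring.valuation π = 1)
    (hy : y ^ 2 + y = algebraMap K L u) : y ∉ (algebraMap K L).fieldRange :=
  (isUniformizerOn_fieldRange hπ).root_notMem (map_artinSchreier_mul_eq_one hu hy)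

theorem isUniformizerOn_inv_root {Q : CurvePoint k L} {π u : K} {y : L}
    (hπ : (Q.image K).ring.valuation.IsUniformizerOn ⊤ π)
    (hu : (Q.image K).ring.valuation u * (Q.image K).ring.valuation π = 1)
    (hy : y ^ 2 + y = algebraMap K L u)
    (hspan : ∀ f : L, ∃ a b : K, f = algebraMap K L a + algebraMap K L b * y) :
    Q.ring.valuation.IsUniformizerOn ⊤ y⁻¹ := by
  refine (isUniformizerOn_fieldRange hπ).of_simple_pole trivial (fun f _ => ?_) ⟨u, hy.symm⟩
    (map_artinSchreier_mul_eq_one hu hy)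
  obtain ⟨a, b, rfl⟩ := hspan f
  exact ⟨_, ⟨a, rfl⟩, _, ⟨b, rfl⟩, rfl⟩

theorem ramIndex_of_simple_pole {Q : CurvePoint k L} {π u : K} {y : L}
    (hπ : (Q.image K).ring.valuation.IsUniformizerOn ⊤ π)
    (hu : (Q.image K).ring.valuation u * (Q.image K).ring.valuation π = 1)
    (hy : y ^ 2 + y = algebraMap K L u)
    (hspan : ∀ f : L, ∃ a b : K, f = algebraMap K L a + algebraMap K L b * y) :
    Q.ramIndex K = 2 := by
  refine ramIndex_eq hπ (isUniformizerOn_inv_root hπ hu hy hspan) ?_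
  rw [(isUniformizerOn_fieldRange hπ).map_eq_root_zpow (map_artinSchreier_mul_eq_one hu hy),
    map_inv₀, inv_pow, zpow_neg, zpow_ofNat]

/-- With t = y⁻¹ and c = u⁻¹, the equation of y becomes t² = c + c t, so the differentials are
𝒪_Q/(c). Since c has the order of π below, it has order 2 at Q. -/
theorem ramCoeff_of_simple_pole [CharP L 2] {Q : CurvePoint k L} {π u : K} {y : L}
    (hπ : (Q.image K).ring.valuation.IsUniformizerOn ⊤ π)
    (hu : (Q.image K).ring.valuation u * (Q.image K).ring.valuation π = 1)
    (hy : y ^ 2 + y = algebraMap K L u)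
    (hspan : ∀ f : L, ∃ a b : K, f = algebraMap K L a + algebraMap K L b * y) :
    Q.ramCoeff K = 2 := by
  have hϖ := isUniformizerOn_inv_root hπ hu hy hspan
  have hy0 : y ≠ 0 := by simpa using hϖ.ne_zero
  have hu0 : u ≠ 0 := by
    rintro rfl
    simp at hu
  have hu0' : algebraMap K L u ≠ 0 := by simpa using hu0
  have hcu : (Q.image K).ring.valuation u⁻¹ = (Q.image K).ring.valuation π := by
    rw [map_inv₀]
    exact inv_eq_of_mul_eq_one_right hu
  have hc : u⁻¹ ∈ (Q.image K).ring := by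
    rw [← ValuationSubring.valuation_le_one_iff, hcu]
    exact hπ.lt_one.le
  have ht : y⁻¹ ∈ Q.ring := (Q.ring.valuation_le_one_iff _).1 hϖ.lt_one.le
  let c : (Q.image K).ring := ⟨u⁻¹, hc⟩
  let t : Q.ring := ⟨y⁻¹, ht⟩
  have : CharP Q.ring 2 := (Q.ring.subtype.charP_iff Q.ring.subtype_injective 2).2 inferInstance
  have htc : t ^ 2 = algebraMap (Q.image K).ring Q.ring c +
      algebraMap (Q.image K).ring Q.ring c * t := by
    refine Subtype.ext ?_
    push_cast
    simp only [coe_localAlgebra_algebraMap, c, t, map_inv₀]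
    rw [← hy] at hu0' ⊢
    have : y + 1 ≠ 0 := fun h => hu0' (by linear_combination y * h)
    field_simp
  have hbij : Function.Bijective fun p : (Q.image K).ring × (Q.image K).ring =>
      algebraMap (Q.image K).ring Q.ring p.1 + algebraMap (Q.image K).ring Q.ring p.2 * t := by
    constructor
    · rintro ⟨a, b⟩ ⟨a', b'⟩ he
      have he' : algebraMap K L a + algebraMap K L b * y⁻¹ =
        algebraMap K L a' + algebraMap K L b' * y⁻¹ := congrArg Subtype.val he
      have hb : (b : K) = b' := by
        by_contra hne
        have hne' : algebraMap K L b' - algebraMap K L b ≠ 0 := by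
          rw [sub_ne_zero]
          exact fun h => hne ((algebraMap K L).injective h).symm
        -- Two different expansions would put y in K, against `root_notMem_fieldRange`.
        have hya : algebraMap K L (((b' : K) - b) / (a - a')) = y := by
          have h1 : algebraMap K L a - algebraMap K L a' =
            (algebraMap K L b' - algebraMap K L b) * y⁻¹ := by linear_combination he'
          rw [map_div₀, map_sub, map_sub, h1]
          field_simp
        exact root_notMem_fieldRange hπ hu hy ⟨_, hya⟩
      have ha : (a : K) = a' := by
        rw [hb] at he'
        exact (algebraMap K L).injective (add_right_cancel he')
      exact Prod.ext (Subtype.ext ha) (Subtype.ext hb)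
    · rintro ⟨f, hf⟩
      obtain ⟨a, b, rfl⟩ := exists_eq_add_mul_inv hy0 hy hspan f
      obtain ⟨ha, hb⟩ := (mem_ring_iff_of_simple_pole hπ hu hy a b).1 hf
      exact ⟨(⟨a, ha⟩, ⟨b, hb⟩), Subtype.ext rfl⟩
  obtain ⟨e⟩ := KaehlerDifferential.nonempty_equiv_of_quadratic c t htc hbij
  have hspan' : Ideal.span {algebraMap (Q.image K).ring Q.ring c} = Ideal.span {t ^ 2} := by
    have hv : Q.ring.valuation (algebraMap (Q.image K).ring Q.ring c : Q.ring) =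
        Q.ring.valuation ((t ^ 2 : Q.ring) : L) := by
      have h1 := (isUniformizerOn_fieldRange hπ).map_eq_root_zpow
        (map_artinSchreier_mul_eq_one hu hy)
      have h2 := (Q.isEquiv_image_valuation (K := K)).eq_iff.1 hcu
      rw [Valuation.comap_apply, Valuation.comap_apply, h1] at h2
      change Q.ring.valuation (algebraMap K L u⁻¹) = Q.ring.valuation (y⁻¹ ^ 2)
      rw [h2, map_pow, map_inv₀, zpow_neg, zpow_ofNat, inv_pow]
    refine le_antisymm ?_ ?_ <;>
      rw [Ideal.span_singleton_le_span_singleton, ValuationSubring.dvd_iff_valuation_le, hv]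
  rw [ramCoeff, ← e.length_eq, hspan']
  exact ValuationSubring.length_quotient_uniformizer_pow (π := t) hϖ 2

/-- An Artin-Schreier cover `Y ^ 2 + Y = u` is totally ramified over the simple poles of `u`, and
their contribution to the ramification divisor is `2`. -/
theorem isTotallyRamified_of_artinSchreier [CharP L 2] {P : CurvePoint k K} {π : K} {y : L}
    (hπ : P.ring.valuation.IsUniformizerOn ⊤ π) (u : K)
    (hu : P.ring.valuation u * P.ring.valuation π = 1)
    (hy : y ^ 2 + y = algebraMap K L u)
    (hspan : ∀ f : L, ∃ a b : K, f = algebraMap K L a + algebraMap K L b * y) :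
    P.IsTotallyRamified L ∧ P.ramContribution L = 2 := by
  obtain ⟨Q, rfl⟩ := P.fiber_nonempty (L := L)
  have hy0 : y ≠ 0 := by
    simpa using (isUniformizerOn_inv_root hπ hu hy hspan).ne_zero
  have hfib : (Q.image K).fiber L = {Q} := by
    refine Set.eq_singleton_iff_unique_mem.2 ⟨rfl, fun Q' hQ' => ?_⟩
    have hQ' : Q'.image K = Q.image K := hQ'
    -- Membership of a + b y⁻¹ in the local ring upstairs depends only on the image point.
    have hr : Q'.ring = Q.ring := by
      ext f
      obtain ⟨a, b, rfl⟩ := exists_eq_add_mul_inv hy0 hy hspan f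
      rw [mem_ring_iff_of_simple_pole hπ hu hy]
      rw [← hQ'] at hπ hu ⊢
      rw [mem_ring_iff_of_simple_pole hπ hu hy]
    cases Q
    cases Q'
    cases hr
    rfl
  refine ⟨⟨Q, hfib, ?_⟩, ?_⟩
  · rw [ramIndex_of_simple_pole hπ hu hy hspan]
    have hli : LinearIndependent K ![(1 : L), y] := by
      rw [LinearIndependent.pair_iff]
      intro a b hab
      rw [Algebra.smul_def, Algebra.smul_def, mul_one] at hab
      have hb : b = 0 := by
        by_contra hb
        have hb' : algebraMap K L b ≠ 0 := by simpa using hb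
        refine root_notMem_fieldRange hπ hu hy ⟨-a / b, ?_⟩
        rw [map_div₀, map_neg]
        field_simp
        linear_combination -hab
      exact ⟨by simpa [hb] using hab, hb⟩
    have hsp : ⊤ ≤ Submodule.span K (Set.range ![(1 : L), y]) := by
      rintro f -
      obtain ⟨a, b, rfl⟩ := hspan f
      simp only [Matrix.range_cons, Matrix.range_empty, Set.union_empty]
      rw [Set.singleton_union, Submodule.mem_span_pair]
      exact ⟨a, b, by rw [Algebra.smul_def, Algebra.smul_def, mul_one]⟩
    rw [Module.finrank_eq_card_basis (Module.Basis.mk hli hsp), Fintype.card_fin]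
  · rw [ramContribution, hfib, finsum_mem_singleton, ramCoeff_of_simple_pole hπ hu hy hspan]

end SimplePole

end

end CurvePoint

/-! ### Values of the coordinates along the tower -/

namespace ArtinSchreierTower

variable {Ω Γ : Type*} [Field Ω] [LinearOrderedCommGroupWithZero Γ] {v : Valuation Ω Γ}

section Values

theorem map_inv_le_one {x : Ω} (hx : 1 < v x) : v (1 / x) ≤ 1 := by
  rw [map_div₀, map_one]
  exact div_le_one_of_le₀ hx.le zero_le

theorem map_rhs_of_one_lt {x : Ω} (hx : 1 < v x) : v (x + 1 + 1 / x) = v x := by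
  rw [add_assoc]
  exact v.map_add_eq_of_lt_left ((v.map_add_le v.map_one.le (map_inv_le_one hx)).trans_lt hx)

theorem one_lt_of_one_lt {x y : Ω} (h : y ^ 2 + y = x + 1 + 1 / x) (hx : 1 < v x) : 1 < v y := by
  rw [← not_le, ← v.map_sq_add_self_le_one_iff, h, map_rhs_of_one_lt hx, not_le]
  exact hx

theorem one_lt_of_lt_one {x y : Ω} (h : y ^ 2 + y = x + 1 + 1 / x) (hx0 : x ≠ 0) (hx : v x < 1) :
    1 < v y := by
  have h1 : 1 < v (1 / x) := by
    rw [one_div]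
    exact (v.val_lt_one_iff hx0).1 hx
  rw [← not_le, ← v.map_sq_add_self_le_one_iff, h, v.map_add_eq_of_lt_right, not_le]
  · exact h1
  · exact (v.map_add_le hx.le v.map_one.le).trans_lt h1

/-- If `s B` satisfies an integral equation with coefficients controlled by `s A`, then it is
integral. -/
theorem map_mul_le_one_of_sq_add_self {s A B : Ω} (hs : v s ≤ 1) (hA : v (s * A) ≤ 1)
    (h : v (B ^ 2 + B + A) ≤ 1) : v (s * B) ≤ 1 := by
  by_contra! hB
  have hB1 : 1 < v B := by
    rw [map_mul] at hB
    exact hB.trans_le (mul_le_of_le_one_left' hs)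
  have h1 : v (s ^ 2 * (B ^ 2 + B)) = v (s * B) ^ 2 := by
    rw [map_mul, v.map_sq_add_self_of_one_lt hB1, map_pow, map_mul, mul_pow]
  have h2 : v (s ^ 2 * (B ^ 2 + B)) ≤ 1 := by
    have : s ^ 2 * (B ^ 2 + B) = s * (s * (B ^ 2 + B + A)) - s * (s * A) := by ring
    rw [this]
    refine v.map_sub_le ?_ ?_
    · rw [map_mul, map_mul]
      exact mul_le_one' hs (mul_le_one' hs h)
    · rw [map_mul]
      exact mul_le_one' hs hA
  rw [h1] at h2
  exact (one_lt_pow₀ hB two_ne_zero).not_ge h2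

/-- The right-hand side vanishes to second order at z = 1, so w reduces there to a root of Y² + Y +
1. The square is what later provides the factor s_l² in `W_equation`. -/
theorem sq_add_self_add_one_eq {z w : Ω} (hz : z ≠ 0) (hw : w ^ 2 + w = z + 1 + 1 / z) :
    w ^ 2 + w + 1 = (z + 1) ^ 2 / z := by
  rw [hw]
  field_simp
  ring

variable [CharP Ω 2]

theorem map_eq_one_of_add_one {z : Ω} (hz : v (z + 1) < 1) : v z = 1 := by
  have h : z = 1 + (z + 1) := by linear_combination -CharTwo.two_eq_zero (R := Ω)
  rw [h, v.map_one_add_of_lt hz]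

/-- Both w and w + 1 are integral and their product is a unit. -/
theorem map_eq_one_of_sq_add_self_add_one {w : Ω} (h : v (w ^ 2 + w + 1) < 1) :
    v w = 1 ∧ v (w + 1) = 1 := by
  have h1 : v (w ^ 2 + w) = 1 := map_eq_one_of_add_one h
  have hw : v w ≤ 1 := v.map_sq_add_self_le_one_iff.1 h1.le
  have hw1 : v (w + 1) ≤ 1 := v.map_add_le hw v.map_one.le
  have h2 : v w * v (w + 1) = 1 := by
    rw [← map_mul, ← h1]
    ring_nf
  constructor
  · refine le_antisymm hw ?_
    rw [← h2]
    exact mul_le_of_le_one_right' hw1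
  · refine le_antisymm hw1 ?_
    rw [← h2]
    exact mul_le_of_le_one_left' hw

/-- Two steps of the tower, starting near `1`. -/
theorem two_steps {z w t : Ω} (hz0 : z + 1 ≠ 0) (hz : v (z + 1) < 1)
    (hw : w ^ 2 + w = z + 1 + 1 / z) (ht : t ^ 2 + t = w + 1 + 1 / w) :
    z ≠ 0 ∧ v z = 1 ∧ w ≠ 0 ∧ v w = 1 ∧ v (w + 1) = 1 ∧
      t * (t + 1) = (z + 1) ^ 2 / (z * w) ∧ v (t * (t + 1)) < 1 ∧ t * (t + 1) ≠ 0 := by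
  have hvz := map_eq_one_of_add_one hz
  have hz' : z ≠ 0 := v.ne_zero_iff.1 (hvz ▸ one_ne_zero)
  have h1 := sq_add_self_add_one_eq hz' hw
  have hsq : v ((z + 1) ^ 2) < 1 := by
    rw [map_pow]
    exact pow_lt_one₀ zero_le hz two_ne_zero
  have h2 : v (w ^ 2 + w + 1) < 1 := by
    rwa [h1, map_div₀, hvz, div_one]
  obtain ⟨hvw, hvw1⟩ := map_eq_one_of_sq_add_self_add_one h2
  have hw' : w ≠ 0 := v.ne_zero_iff.1 (hvw ▸ one_ne_zero)
  have h3 : t * (t + 1) = (z + 1) ^ 2 / (z * w) := by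
    have : t * (t + 1) = (w ^ 2 + w + 1) / w := by
      rw [mul_add, mul_one, ← sq, ht]
      field_simp
    rw [this, h1, div_div]
  refine ⟨hz', hvz, hw', hvw, hvw1, h3, ?_, ?_⟩
  · rwa [h3, map_div₀, map_mul, hvz, hvw, mul_one, div_one]
  · rw [h3]
    exact div_ne_zero (pow_ne_zero 2 hz0) (mul_ne_zero hz' hw')

end Values

/-! ### The function fields and the starting point on the line -/

section Fields

variable {k : Type*} [Field k] [Algebra k Ω]

theorem map_aeval_le_one (hk : ∀ c : k, v (algebraMap k Ω c) ≤ 1) {x : Ω} (hx : v x ≤ 1)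
    (p : Polynomial k) : v (Polynomial.aeval x p) ≤ 1 := by
  rw [Polynomial.aeval_eq_sum_range]
  refine v.map_sum_le fun i _ => ?_
  rw [Algebra.smul_def, map_mul, map_pow]
  exact mul_le_one' (hk _) (pow_le_one₀ zero_le hx)

theorem map_algebraMap_eq_one (hk : ∀ c : k, v (algebraMap k Ω c) ≤ 1) {c : k} (hc : c ≠ 0) :
    v (algebraMap k Ω c) = 1 := by
  refine le_antisymm (hk c) ?_
  have h := hk c⁻¹
  rwa [map_inv₀, ← v.one_le_val_iff (by simpa using hc)] at h

variable [IsAlgClosed Ω] {x₀ : Ω}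

theorem coord_sq_add_self_mem (n : ℕ) :
    coord x₀ (n + 1) ^ 2 + coord x₀ (n + 1) ∈ functionField k x₀ n := by
  have := coord_mem k x₀ (le_refl n)
  rw [coord_succ]
  exact add_mem (add_mem this (one_mem _)) (div_mem (one_mem _) this)

theorem functionField_mono {m n : ℕ} (h : m ≤ n) : functionField k x₀ m ≤ functionField k x₀ n :=
  monotone_nat_of_le_succ (functionField_le_succ k x₀) h

theorem exists_eq_add_mul_coord [CharP Ω 2] {n : ℕ} {f : Ω} (hf : f ∈ functionField k x₀ (n + 1)) :
    ∃ a ∈ functionField k x₀ n, ∃ b ∈ functionField k x₀ n, f = a + b * coord x₀ (n + 1) := by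
  have h2 : (2 : Ω) = 0 := CharTwo.two_eq_zero
  have hy := coord_sq_add_self_mem (k := k) (x₀ := x₀) n
  set y := coord x₀ (n + 1)
  induction hf using IntermediateField.adjoin_induction with
  | mem f hf =>
    obtain ⟨m, hm, rfl⟩ := hf
    rcases hm.lt_or_eq with h | rfl
    · exact ⟨_, coord_mem k x₀ (by omega : m ≤ n), 0, zero_mem _, by ring⟩
    · exact ⟨0, zero_mem _, 1, one_mem _, by simp [y]⟩
  | algebraMap c => exact ⟨_, (functionField k x₀ n).algebraMap_mem c, 0, zero_mem _, by ring⟩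
  | add f g _ _ hf hg =>
    obtain ⟨a, ha, b, hb, rfl⟩ := hf
    obtain ⟨a', ha', b', hb', rfl⟩ := hg
    exact ⟨_, add_mem ha ha', _, add_mem hb hb', by ring⟩
  | inv f _ hf =>
    obtain ⟨a, ha, b, hb, rfl⟩ := hf
    -- The conjugation y ↦ y + 1 turns a + b y into a + b + b y; their product is the norm.
    -- Irreducibility of the equation is not known here, so a vanishing conjugate is a separate case
    -- below.
    have hN : (a + b * y) * (a + b + b * y) = a ^ 2 + a * b + b ^ 2 * (y ^ 2 + y) := by
      linear_combination (a * b * y) * h2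
    have hNE : a ^ 2 + a * b + b ^ 2 * (y ^ 2 + y) ∈ functionField k x₀ n :=
      add_mem (add_mem (pow_mem ha 2) (mul_mem ha hb)) (mul_mem (pow_mem hb 2) hy)
    rw [← hN] at hNE
    by_cases h0 : a + b * y = 0
    · exact ⟨0, zero_mem _, 0, zero_mem _, by simp [h0]⟩
    by_cases h1 : a + b + b * y = 0
    · refine ⟨b⁻¹, inv_mem hb, 0, zero_mem _, ?_⟩
      have : a + b * y = b := by linear_combination h1 - b * h2
      rw [this]
      ring
    · refine ⟨_, div_mem (add_mem ha hb) hNE, _, div_mem hb hNE, ?_⟩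
      field_simp
  | mul f g _ _ hf hg =>
    obtain ⟨a, ha, b, hb, rfl⟩ := hf
    obtain ⟨a', ha', b', hb', rfl⟩ := hg
    refine ⟨a * a' + b * b' * (y ^ 2 + y), add_mem (mul_mem ha ha') (mul_mem (mul_mem hb hb') hy),
      a * b' + a' * b - b * b', sub_mem (add_mem (mul_mem ha hb') (mul_mem ha' hb))
        (mul_mem hb hb'), by ring⟩

theorem exists_eq_add_mul_coord_add [CharP Ω 2] {n : ℕ} {f g : Ω}
    (hf : f ∈ functionField k x₀ (n + 1)) (hg : g ∈ functionField k x₀ n) :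
    ∃ a ∈ functionField k x₀ n, ∃ b ∈ functionField k x₀ n,
      f = a + b * (coord x₀ (n + 1) + g) := by
  obtain ⟨a, ha, b, hb, rfl⟩ := exists_eq_add_mul_coord hf
  exact ⟨a - b * g, sub_mem ha (mul_mem hb hg), b, hb, by ring⟩

theorem functionField_zero : functionField k x₀ 0 = IntermediateField.adjoin k {x₀} := by
  rw [functionField]
  congr 1
  ext y
  constructor
  · rintro ⟨m, hm, rfl⟩
    obtain rfl : m = 0 := by omega
    rfl
  · rintro rfl
    exact ⟨0, le_rfl, rfl⟩

/-- The point with coordinate `c` on the projective line has uniformizer `x₀ - c`. -/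
theorem isUniformizerOn_functionField_zero (hk : ∀ c : k, v (algebraMap k Ω c) ≤ 1) (c : k)
    (h0 : x₀ - algebraMap k Ω c ≠ 0) (h1 : v (x₀ - algebraMap k Ω c) < 1) :
    v.IsUniformizerOn (functionField k x₀ 0).toSubfield (x₀ - algebraMap k Ω c) := by
  set π := x₀ - algebraMap k Ω c
  have hx : v x₀ ≤ 1 := by
    have : x₀ = π + algebraMap k Ω c := by ring
    rw [this]
    exact v.map_add_le h1.le (hk c)
  -- Factor p = (X - c)^n q with q(c) ≠ 0: then q(x₀) is the unit q(c) plus a multiple of π.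
  have hpoly : ∀ p : Polynomial k, Polynomial.aeval x₀ p ≠ 0 →
      ∃ n : ℕ, v (Polynomial.aeval x₀ p) = v π ^ n := by
    intro p hp
    have hp0 : p ≠ 0 := by
      rintro rfl
      simp at hp
    obtain ⟨q, hpq, hq⟩ := Polynomial.exists_eq_pow_rootMultiplicity_mul_and_not_dvd p hp0 c
    refine ⟨p.rootMultiplicity c, ?_⟩
    have hqc : q.eval c ≠ 0 := fun h => hq (Polynomial.dvd_iff_isRoot.2 h)
    obtain ⟨r, hr⟩ := Polynomial.X_sub_C_dvd_sub_C_eval (a := c) (p := q)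
    have hq1 : v (Polynomial.aeval x₀ q) = 1 := by
      have : Polynomial.aeval x₀ q = algebraMap k Ω (q.eval c) + π * Polynomial.aeval x₀ r := by
        have := congrArg (Polynomial.aeval x₀) hr
        simp only [map_sub, map_mul, Polynomial.aeval_X, Polynomial.aeval_C] at this
        linear_combination this
      have hvc := map_algebraMap_eq_one hk hqc
      rw [this, v.map_add_eq_of_lt_left, hvc]
      rw [hvc, map_mul]
      exact (mul_le_of_le_one_right' (map_aeval_le_one hk hx r)).trans_lt h1
    conv_lhs => rw [hpq]
    simp only [map_mul, map_pow, map_sub, Polynomial.aeval_X, Polynomial.aeval_C, hq1, mul_one]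
    rfl
  refine ⟨sub_mem (coord_mem k x₀ (le_refl 0)) ((functionField k x₀ 0).algebraMap_mem c), h0, h1,
    fun f hf hf0 => ?_⟩
  have hf' : f ∈ IntermediateField.adjoin k {x₀} := by
    rw [← functionField_zero]
    exact hf
  obtain ⟨p, q, rfl⟩ := (IntermediateField.mem_adjoin_simple_iff k f).1 hf'
  obtain ⟨hp0, hq0⟩ := div_ne_zero_iff.1 hf0
  obtain ⟨n, hn⟩ := hpoly p hp0
  obtain ⟨m, hm⟩ := hpoly q hq0
  refine ⟨n - m, ?_⟩
  rw [map_div₀, hn, hm, zpow_sub₀ (v.ne_zero_iff.2 h0), zpow_natCast, zpow_natCast]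

end Fields

end ArtinSchreierTower

/-! ### The alternating reduction above the zero of x_i -/

namespace ArtinSchreierTower

variable {Ω Γ : Type*} [Field Ω] [LinearOrderedCommGroupWithZero Γ]
  {k : Type*} [Field k] [Algebra k Ω]

/-- The data governing the poles of the tower above a point `(1, ω, 1, …, ω, 0)` of `C_{2m}`: the
functions `s l` are `x_{2l} + 1` for `l < m` and `x_{2m}` for `l = m`, and `W l = x_{2l+1} + 1`. -/
structure ReductionData (v : Valuation Ω Γ) (E : IntermediateField k Ω) (m : ℕ) (s W : ℕ → Ω) :
    Prop where
  s_mem : ∀ l ≤ m, s l ∈ E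
  s_ne_zero : ∀ l ≤ m, s l ≠ 0
  s_lt_one : ∀ l ≤ m, v (s l) < 1
  W_mem : ∀ l < m, W l ∈ E
  W_le_one : ∀ l < m, v (W l) ≤ 1
  W_add_one : ∀ l < m, v (W l + 1) = 1
  W_equation : ∀ l < m, ∃ c, v c ≤ 1 ∧ W l ^ 2 + W l + 1 = c * s l ^ 2
  inv_s : ∀ l < m, v (1 / s (l + 1) + ((W l * (1 / s l)) ^ 2 + W l * (1 / s l)) + 1 / s l) ≤ 1

/-- The state of the reduction when the last step is unramified: the right-hand side of the next
equation is equivalent to each `A l`, modulo functions `g ^ 2 + g` and regular functions, and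
`A q` has a simple pole. -/
structure EvenStage (v : Valuation Ω Γ) (E : IntermediateField k Ω) (q m : ℕ) (s W : ℕ → Ω)
    (x : Ω) (A : ℕ → Ω) (π : Ω) : Prop where
  uniformizer : v.IsUniformizerOn E.toSubfield π
  mem : ∀ l, q ≤ l → l ≤ m → A l ∈ E
  mul_le_one : ∀ l, q ≤ l → l ≤ m → v (s l * A l) ≤ 1
  step : ∀ l, q ≤ l → l < m → v (A (l + 1) + ((W l * A l) ^ 2 + W l * A l) + A l) ≤ 1
  simple_pole : v (A q) * v π = 1
  last : v (A m + (x + 1 + 1 / x)) ≤ 1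

/-- The state of the reduction when the last step is ramified: each `H l` is equivalent to `0`,
modulo functions `g ^ 2 + g` and regular functions, and `H q` has a simple pole. -/
structure OddStage (v : Valuation Ω Γ) (E : IntermediateField k Ω) (q m : ℕ) (s W : ℕ → Ω)
    (x : Ω) (H : ℕ → Ω) (π : Ω) : Prop where
  uniformizer : v.IsUniformizerOn E.toSubfield π
  mem : ∀ l, q ≤ l → l ≤ m → H l ∈ E
  mul_le_one : ∀ l, q ≤ l → l ≤ m → v (s l * H l) ≤ 1
  step : ∀ l, q ≤ l → l < m →
    v (H (l + 1) + (((W l + 1) * H l) ^ 2 + (W l + 1) * H l)) ≤ 1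
  simple_pole : v (H q) * v π = 1
  last : H m = x

variable {v : Valuation Ω Γ} {x₀ : Ω} {m : ℕ} {s W : ℕ → Ω}

theorem sum_sq_add_self [CharP Ω 2] (I : Finset ℕ) (f : ℕ → Ω) :
    (∑ l ∈ I, f l) ^ 2 + ∑ l ∈ I, f l = ∑ l ∈ I, (f l ^ 2 + f l) := by
  rw [CharTwo.sum_sq, Finset.sum_add_distrib]

/-- Starting from u ≡ A_m, the relations in `step` telescope downwards because squaring is additive.
The accumulated correction is ℘ of the sum of the W_r A_r. -/
theorem EvenStage.rhs_equiv [CharP Ω 2] {E : IntermediateField k Ω} {q : ℕ} {x π : Ω}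
    {A : ℕ → Ω} (h : EvenStage v E q m s W x A π) {l : ℕ} (hql : q ≤ l) (hlm : l ≤ m) :
    v (x + 1 + 1 / x + ((∑ i ∈ Finset.Ico l m, W i * A i) ^ 2 +
      ∑ i ∈ Finset.Ico l m, W i * A i) + A l) ≤ 1 := by
  have h2 : (2 : Ω) = 0 := CharTwo.two_eq_zero
  induction hlm using Nat.decreasingInduction with
  | self =>
    have := h.last
    simpa [add_comm] using this
  | of_succ l hl ih =>
    have h1 := ih (by omega)
    rw [sum_sq_add_self] at h1 ⊢
    rw [← Finset.add_sum_Ioo_eq_sum_Ico hl]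
    have hI : Finset.Ioo l m = Finset.Ico (l + 1) m := by ext; simp
    rw [hI]
    have := v.map_add_le h1 (h.step l hql hl)
    convert this using 2
    linear_combination -(A (l + 1)) * h2

theorem sum_mem {E : IntermediateField k Ω} {q l : ℕ} {A : ℕ → Ω} (hW : ∀ i < m, W i ∈ E)
    (hA : ∀ l, q ≤ l → l ≤ m → A l ∈ E) (hl : q ≤ l) : ∑ i ∈ Finset.Ico l m, W i * A i ∈ E := by
  refine _root_.sum_mem fun i hi => ?_
  rw [Finset.mem_Ico] at hi
  exact mul_mem (hW i hi.2) (hA i (by omega) (by omega))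

theorem one_lt_of_mul_eq_one {a b : Γ} (h : a * b = 1) (hb : b < 1) : 1 < a := by
  by_contra! ha
  have := mul_le_of_le_one_left' (a := b) ha
  rw [h] at this
  exact hb.not_ge this

theorem EvenStage.one_lt {E : IntermediateField k Ω} {q : ℕ} {x π : Ω}
    {A : ℕ → Ω} (h : EvenStage v E q m s W x A π) : 1 < v (A q) :=
  one_lt_of_mul_eq_one h.simple_pole h.uniformizer.lt_one

/-- In the even stages, the right-hand side of the next equation has a simple pole, up to adding a
function `g ^ 2 + g`. -/
theorem EvenStage.simple_pole_rhs [CharP Ω 2] {E : IntermediateField k Ω} {q : ℕ} {x π : Ω}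
    {A : ℕ → Ω} (h : EvenStage v E q m s W x A π) (hqm : q ≤ m) :
    v (x + 1 + 1 / x + ((∑ i ∈ Finset.Ico q m, W i * A i) ^ 2 +
      ∑ i ∈ Finset.Ico q m, W i * A i)) * v π = 1 := by
  have h1 := h.rhs_equiv le_rfl hqm
  rw [← CharTwo.sub_eq_add _ (A q)] at h1
  rw [v.map_eq_of_sub_lt (h1.trans_lt h.one_lt), h.simple_pole]

theorem EvenStage.next [IsAlgClosed Ω] [CharP Ω 2] {n q : ℕ} {A : ℕ → Ω} {π : Ω}
    (hR : ReductionData v (functionField k x₀ n) m s W)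
    (h : EvenStage v (functionField k x₀ n) q m s W (coord x₀ n) A π) (hqm : q ≤ m) :
    ∃ H π', OddStage v (functionField k x₀ (n + 1)) q m s W (coord x₀ (n + 1)) H π' := by
  have h2 : (2 : Ω) = 0 := CharTwo.two_eq_zero
  have hle := functionField_le_succ k x₀ n
  set y := coord x₀ (n + 1)
  have hyu : y ^ 2 + y = coord x₀ n + 1 + 1 / coord x₀ n := coord_succ x₀ n
  -- Adding the telescoping sum to y turns its equation into ℘(H_l) ≡ A_l. At l = m the sum is
  -- empty, so H_m = y.
  let H : ℕ → Ω := fun l => y + ∑ i ∈ Finset.Ico l m, W i * A i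
  have hHu : ∀ l, H l ^ 2 + H l = coord x₀ n + 1 + 1 / coord x₀ n +
      ((∑ i ∈ Finset.Ico l m, W i * A i) ^ 2 + ∑ i ∈ Finset.Ico l m, W i * A i) := fun l => by
    rw [← hyu]
    linear_combination (y * ∑ i ∈ Finset.Ico l m, W i * A i) * h2
  have hHA : ∀ l, q ≤ l → l ≤ m → v (H l ^ 2 + H l + A l) ≤ 1 := fun l hq hl => by
    rw [hHu]
    exact h.rhs_equiv hq hl
  have hHmem : ∀ l, q ≤ l → H l ∈ functionField k x₀ (n + 1) := fun l hl =>
    add_mem (coord_mem k x₀ le_rfl) (hle (sum_mem hR.W_mem h.mem hl))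
  have hsH : ∀ l, q ≤ l → l ≤ m → v (s l * H l) ≤ 1 := fun l hq hl =>
    map_mul_le_one_of_sq_add_self (hR.s_lt_one l hl).le (h.mul_le_one l hq hl) (hHA l hq hl)
  have hpole : v (H q ^ 2 + H q) * v π = 1 := by
    rw [hHu]
    exact h.simple_pole_rhs hqm
  refine ⟨H, (H q)⁻¹, ?_, fun l hq _ => hHmem l hq, hsH, fun l hq hl => ?_, ?_, by simp [H]⟩
  · refine h.uniformizer.of_simple_pole (hHmem q le_rfl) (fun f hf => ?_) ?_ hpole
    · exact exists_eq_add_mul_coord_add hf (sum_mem hR.W_mem h.mem le_rfl)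
    · have hm := sum_mem hR.W_mem h.mem (le_refl q)
      rw [hHu, ← hyu]
      exact add_mem (coord_sq_add_self_mem n) (add_mem (pow_mem hm 2) hm)
  · obtain ⟨c, hc, hWc⟩ := hR.W_equation l hl
    have hH : H l = H (l + 1) + W l * A l := by
      have hI : Finset.Ioo l m = Finset.Ico (l + 1) m := by ext; simp
      simp only [H]
      rw [← Finset.add_sum_Ioo_eq_sum_Ico hl, hI]
      ring
    -- Here (W + 1)² = W + c s² by `W_equation` and H_{l+1} = H_l + W_l A_l. Both remaining terms
    -- are regular, the first because s_l H_l is.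
    have he : H (l + 1) + (((W l + 1) * H l) ^ 2 + (W l + 1) * H l) =
        c * (s l * H l) ^ 2 + W l * (H l ^ 2 + H l + A l) := by
      linear_combination -hH + H l ^ 2 * hWc + (H l - W l * A l) * h2
    rw [he]
    refine v.map_add_le ?_ ?_
    · rw [map_mul, map_pow]
      exact mul_le_one' hc (pow_le_one₀ zero_le (hsH l hq hl.le))
    · rw [map_mul]
      exact mul_le_one' (hR.W_le_one l hl) (hHA l hq hl.le)
  · rw [← map_mul, mul_inv_cancel₀ (h.uniformizer.root_ne_zero hpole), map_one]

/-- In the odd stages, the right-hand side of the next equation is regular, up to adding a function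
`g ^ 2 + g`. -/
theorem OddStage.regular_rhs {E : IntermediateField k Ω} {q : ℕ} {x π : Ω}
    {H : ℕ → Ω} (h : OddStage v E q (m + 1) s W x H π) (hqm : q ≤ m) (hx : 1 < v x) :
    v (x + 1 + 1 / x + (((W m + 1) * H m) ^ 2 + (W m + 1) * H m)) ≤ 1 := by
  have h1 := h.step m hqm (by omega)
  rw [h.last] at h1
  have := v.map_add_le h1 (v.map_add_le v.map_one.le (map_inv_le_one hx))
  convert this using 2
  ring

theorem OddStage.next [IsAlgClosed Ω] [CharP Ω 2] {n q : ℕ} {H : ℕ → Ω} {π : Ω}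
    (hR : ReductionData v (functionField k x₀ n) m s W)
    (h : OddStage v (functionField k x₀ n) q m s W (coord x₀ n) H π) (hqm : q < m)
    (hx : 1 < v (coord x₀ n)) :
    ∃ A, EvenStage v (functionField k x₀ (n + 1)) (q + 1) m s W (coord x₀ (n + 1)) A π := by
  have h2 : (2 : Ω) = 0 := CharTwo.two_eq_zero
  have hle := functionField_le_succ k x₀ n
  obtain ⟨m, rfl⟩ : ∃ m', m = m' + 1 := ⟨m - 1, by omega⟩
  set y := coord x₀ (n + 1)
  have hyu : y ^ 2 + y = coord x₀ n + 1 + 1 / coord x₀ n := coord_succ x₀ n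
  have hyv : 1 < v y := one_lt_of_one_lt hyu hx
  -- The shift makes ℘(A_{l+1}) ≡ H_{l+1}. The truncated value at l = 0 is never used, since the new
  -- stage starts at q + 1.
  let A : ℕ → Ω := fun l => (W (l - 1) + 1) * H (l - 1)
  have hA : ∀ l, A (l + 1) = (W l + 1) * H l := fun l => rfl
  have hAmem : ∀ l, q ≤ l → l ≤ m → A (l + 1) ∈ functionField k x₀ n := fun l hq hl =>
    mul_mem (add_mem (hR.W_mem l (by omega)) (one_mem _)) (h.mem l hq (by omega))
  have hHA : ∀ l, q ≤ l → l ≤ m → v (A (l + 1) ^ 2 + A (l + 1) + H (l + 1)) ≤ 1 :=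
    fun l hq hl => by
      have := h.step l hq (by omega)
      rwa [add_comm, ← hA] at this
  have hsA : ∀ l, q ≤ l → l ≤ m → v (s (l + 1) * A (l + 1)) ≤ 1 := fun l hq hl =>
    map_mul_le_one_of_sq_add_self (hR.s_lt_one _ (by omega)).le
      (h.mul_le_one _ (by omega) (by omega)) (hHA l hq hl)
  have hd2 : (y + A (m + 1)) ^ 2 + (y + A (m + 1)) =
      coord x₀ n + 1 + 1 / coord x₀ n + (A (m + 1) ^ 2 + A (m + 1)) := by
    rw [← hyu]
    linear_combination (y * A (m + 1)) * h2
  have hd1 : v ((y + A (m + 1)) ^ 2 + (y + A (m + 1))) ≤ 1 := by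
    rw [hd2, hA]
    exact h.regular_rhs (by omega) hx
  have hd := v.map_sq_add_self_le_one_iff.1 hd1
  refine ⟨A, ?_, ?_, ?_, ?_, ?_, ?_⟩
  · refine h.uniformizer.of_integral hle (fun f hf => ?_) ?_ hd1
    · exact exists_eq_add_mul_coord_add hf (hAmem m (by omega) le_rfl)
    · have hm := hAmem m (by omega) le_rfl
      rw [hd2, ← hyu]
      exact add_mem (coord_sq_add_self_mem n) (add_mem (pow_mem hm 2) hm)
  · intro l hq hl
    obtain ⟨l, rfl⟩ : ∃ l', l = l' + 1 := ⟨l - 1, by omega⟩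
    exact hle (hAmem l (by omega) (by omega))
  · intro l hq hl
    obtain ⟨l, rfl⟩ : ∃ l', l = l' + 1 := ⟨l - 1, by omega⟩
    exact hsA l (by omega) (by omega)
  · intro l hq hl
    obtain ⟨l, rfl⟩ : ∃ l', l = l' + 1 := ⟨l - 1, by omega⟩
    obtain ⟨c, hc, hWc⟩ := hR.W_equation (l + 1) hl
    -- Now W² = W + 1 + c s² is used, with A_{l+2} = (W_{l+1} + 1) H_{l+1}; the last bracket is
    -- regular by `hHA`.
    have he : A (l + 1 + 1) + ((W (l + 1) * A (l + 1)) ^ 2 + W (l + 1) * A (l + 1)) + A (l + 1) =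
        c * (s (l + 1) * A (l + 1)) ^ 2 +
          (W (l + 1) + 1) * (A (l + 1) ^ 2 + A (l + 1) + H (l + 1)) := by
      linear_combination hA (l + 1) + A (l + 1) ^ 2 * hWc -
        (W (l + 1) * A (l + 1) ^ 2 + A (l + 1) ^ 2) * h2
    rw [he]
    refine v.map_add_le ?_ ?_
    · rw [map_mul, map_pow]
      exact mul_le_one' hc (pow_le_one₀ zero_le (hsA l (by omega) (by omega)))
    · rw [map_mul, hR.W_add_one _ hl, one_mul]
      exact hHA l (by omega) (by omega)
  -- The factor W_q + 1 is a unit and the step is unramified, so the simple pole of H_q passes to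
  -- A_{q+1} with the same π.
  · rw [hA, map_mul, hR.W_add_one q hqm, one_mul, h.simple_pole]
  · have := v.map_add_le hd (v.map_add_le v.map_one.le (map_inv_le_one hyv))
    convert this using 2
    ring

end ArtinSchreierTower

/-! ### Initial data and the induction over the stages -/

namespace ArtinSchreierTower

variable {Ω Γ : Type*} [Field Ω] [LinearOrderedCommGroupWithZero Γ]
  {k : Type*} [Field k] [Algebra k Ω] {v : Valuation Ω Γ} {x₀ : Ω} {m : ℕ} {s W : ℕ → Ω}

theorem ReductionData.mono {E E' : IntermediateField k Ω} (h : ReductionData v E m s W)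
    (hE : E ≤ E') : ReductionData v E' m s W :=
  { h with
    s_mem := fun l hl => hE (h.s_mem l hl)
    W_mem := fun l hl => hE (h.W_mem l hl) }

/-- The sum equals 1/(τ + 1) + 1/z exactly, and both denominators are units. The hypothesis on τ(τ +
1) is symmetric under τ ↦ τ + 1, so the lemma covers x_{2l+2} near 1 as well as near 0. -/
theorem inv_reduction [CharP Ω 2] {z w τ : Ω} (hz0 : z + 1 ≠ 0) (hz : v z = 1) (hw : w ≠ 0)
    (hzw : w ^ 2 + w + 1 = (z + 1) ^ 2 / z) (hτ : τ * (τ + 1) = (z + 1) ^ 2 / (z * w))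
    (hvτ : v τ < 1) :
    v (1 / τ + (((w + 1) * (1 / (z + 1))) ^ 2 + (w + 1) * (1 / (z + 1))) + 1 / (z + 1)) ≤ 1 := by
  have h2 : (2 : Ω) = 0 := CharTwo.two_eq_zero
  have hz' : z ≠ 0 := v.ne_zero_iff.1 (hz ▸ one_ne_zero)
  have hne : τ * (τ + 1) ≠ 0 := by
    rw [hτ]
    exact div_ne_zero (pow_ne_zero 2 hz0) (mul_ne_zero hz' hw)
  obtain ⟨hτ0, hτ1⟩ := mul_ne_zero_iff.1 hne
  rw [eq_div_iff (mul_ne_zero hz' hw)] at hτ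
  rw [eq_div_iff hz'] at hzw
  have e1 : 1 / τ = (τ + 1) * z * w / (z + 1) ^ 2 := by
    rw [← hτ]
    field_simp
  have e2 : 1 / (τ + 1) = τ * z * w / (z + 1) ^ 2 := by
    rw [← hτ]
    field_simp
  have e3 : 1 / z = (w ^ 2 + w + 1) / (z + 1) ^ 2 := by
    rw [div_eq_div_iff hz' (pow_ne_zero 2 hz0), hzw, one_mul]
  have key : 1 / τ + (((w + 1) * (1 / (z + 1))) ^ 2 + (w + 1) * (1 / (z + 1))) + 1 / (z + 1) =
      1 / (τ + 1) + 1 / z := by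
    rw [e1, e2, e3]
    field_simp
    linear_combination (z * w + w + z + 1) * h2
  rw [key]
  refine v.map_add_le ?_ ?_
  · rw [map_div₀, map_one, add_comm, v.map_one_add_of_lt hvτ, div_one]
  · rw [map_div₀, map_one, hz, div_one]

variable [IsAlgClosed Ω]

theorem one_lt_coord_of_le {n n' : ℕ} (h : 1 < v (coord x₀ n)) (hn : n ≤ n') :
    1 < v (coord x₀ n') := by
  induction hn with
  | refl => exact h
  | step _ ih => exact one_lt_of_one_lt (coord_succ x₀ _) ih

theorem one_lt_coord_of_lt {n n' : ℕ} (h0 : coord x₀ n ≠ 0) (h : v (coord x₀ n) < 1)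
    (hn : n < n') : 1 < v (coord x₀ n') :=
  one_lt_coord_of_le (one_lt_of_lt_one (coord_succ x₀ n) h0 h) hn

/-- In the tower over `x₀ = 1`, the functions `x_{2l}` have value `1` until one of the coordinates
has value `0`. -/
theorem coord_even_near_one [CharP Ω 2] {i : ℕ} (h0 : x₀ + 1 ≠ 0) (hv0 : v (x₀ + 1) < 1)
    (hvi : v (coord x₀ i) < 1) (l : ℕ) (hl : 2 * l < i) :
    coord x₀ (2 * l) + 1 ≠ 0 ∧ v (coord x₀ (2 * l) + 1) < 1 := by
  induction l with
  | zero => exact ⟨h0, hv0⟩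
  | succ l ih =>
    obtain ⟨h1, h2⟩ := ih (by omega)
    obtain ⟨-, -, -, -, -, -, hlt, hne⟩ :=
      two_steps h1 h2 (coord_succ x₀ (2 * l)) (coord_succ x₀ (2 * l + 1))
    change v (coord x₀ (2 * (l + 1)) * (coord x₀ (2 * (l + 1)) + 1)) < 1 at hlt
    change coord x₀ (2 * (l + 1)) * (coord x₀ (2 * (l + 1)) + 1) ≠ 0 at hne
    obtain ⟨hne0, hne1⟩ := mul_ne_zero_iff.1 hne
    refine ⟨hne1, ?_⟩
    -- The product x_{2l+2}(x_{2l+2} + 1) is small, so otherwise x_{2l+2} would vanish at the point.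
    -- Every later coordinate, x_i included, would then have a pole.
    by_contra! hge
    have hlt' : v (coord x₀ (2 * (l + 1))) < 1 := by
      rw [map_mul] at hlt
      exact (le_mul_of_one_le_right' hge).trans_lt hlt
    exact (one_lt_coord_of_lt hne0 hlt' hl).not_gt hvi

theorem map_coord_eq_one [CharP Ω 2] {i : ℕ} (h0 : x₀ + 1 ≠ 0) (hv0 : v (x₀ + 1) < 1)
    (hvi : v (coord x₀ i) < 1) {n : ℕ} (hn : n < i) : v (coord x₀ n) = 1 := by
  obtain ⟨l, rfl | rfl⟩ := n.even_or_odd'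
  · exact map_eq_one_of_add_one (coord_even_near_one h0 hv0 hvi l hn).2
  · obtain ⟨h1, h2⟩ := coord_even_near_one h0 hv0 hvi l (by omega)
    exact (two_steps h1 h2 (coord_succ x₀ (2 * l)) (coord_succ x₀ (2 * l + 1))).2.2.2.1

theorem exists_eq_two_mul [CharP Ω 2] {i : ℕ} (h0 : x₀ + 1 ≠ 0) (hv0 : v (x₀ + 1) < 1)
    (hvi : v (coord x₀ i) < 1) : ∃ m, i = 2 * m := by
  obtain ⟨l, rfl | rfl⟩ := i.even_or_odd'
  · exact ⟨l, rfl⟩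
  · obtain ⟨h1, h2⟩ := coord_even_near_one h0 hv0 hvi l (by omega)
    have := (two_steps h1 h2 (coord_succ x₀ (2 * l)) (coord_succ x₀ (2 * l + 1))).2.2.2.1
    exact absurd this hvi.ne

/-- The cover `C_i / C_0` is unramified at the points with `x_n` a unit for `n < i`. -/
theorem isUniformizerOn_of_map_coord_eq_one [CharP Ω 2] {i : ℕ} {π : Ω}
    (hπ : v.IsUniformizerOn (functionField k x₀ 0).toSubfield π)
    (hx : ∀ n < i, v (coord x₀ n) = 1) :
    v.IsUniformizerOn (functionField k x₀ i).toSubfield π := by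
  induction i with
  | zero => exact hπ
  | succ n ih =>
    refine (ih fun l hl => hx l (by omega)).of_integral (functionField_le_succ k x₀ n)
      (fun f hf => exists_eq_add_mul_coord hf) (coord_sq_add_self_mem n) ?_
    have h1 := hx n (by omega)
    rw [coord_succ]
    refine v.map_add_le (v.map_add_le h1.le v.map_one.le) ?_
    rw [map_div₀, h1, map_one, div_one]

theorem exists_reductionData [CharP Ω 2] {m : ℕ} (hm : 1 ≤ m) (h0 : x₀ + 1 ≠ 0)
    (hv0 : v (x₀ + 1) < 1) (hvi : v (coord x₀ (2 * m)) < 1) :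
    ∃ s W, ReductionData v (functionField k x₀ (2 * m)) m s W ∧ s 0 = x₀ + 1 ∧
      s m = coord x₀ (2 * m) := by
  have h2 : (2 : Ω) = 0 := CharTwo.two_eq_zero
  -- In each case s_l is the factor of x_{2l}(x_{2l} + 1) that vanishes at the point.
  let s : ℕ → Ω := fun l => if l < m then coord x₀ (2 * l) + 1 else coord x₀ (2 * l)
  have hs : ∀ l < m, s l = coord x₀ (2 * l) + 1 := fun l hl => if_pos hl
  have hsm : s m = coord x₀ (2 * m) := if_neg (lt_irrefl m)
  have hnear : ∀ l < m, coord x₀ (2 * l) + 1 ≠ 0 ∧ v (coord x₀ (2 * l) + 1) < 1 := fun l hl =>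
    coord_even_near_one h0 hv0 hvi l (by omega)
  have hstep := fun l (hl : l < m) => two_steps (hnear l hl).1 (hnear l hl).2
    (coord_succ x₀ (2 * l)) (coord_succ x₀ (2 * l + 1))
  have hlt : ∀ l ≤ m, v (s l) < 1 := by
    intro l hl
    rcases hl.lt_or_eq with h | rfl
    · rw [hs l h]
      exact (hnear l h).2
    · rwa [hsm]
  have hne : ∀ l ≤ m, s l ≠ 0 := by
    intro l hl
    rcases hl.lt_or_eq with h | rfl
    · rw [hs l h]
      exact (hnear l h).1
    · obtain ⟨l, rfl⟩ : ∃ l', l = l' + 1 := ⟨l - 1, by omega⟩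
      rw [hsm]
      exact (mul_ne_zero_iff.1 (hstep l (by omega)).2.2.2.2.2.2.2).1
  refine ⟨s, fun l => coord x₀ (2 * l + 1) + 1, ⟨?_, hne, hlt, ?_, ?_, ?_, ?_, ?_⟩,
    hs 0 (by omega), hsm⟩
  · intro l hl
    have := coord_mem k x₀ (by omega : 2 * l ≤ 2 * m)
    rcases hl.lt_or_eq with h | rfl
    · rw [hs l h]
      exact add_mem this (one_mem _)
    · rwa [hsm]
  · exact fun l hl => add_mem (coord_mem k x₀ (by omega)) (one_mem _)
  · exact fun l hl => (hstep l hl).2.2.2.2.1.le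
  · intro l hl
    have : coord x₀ (2 * l + 1) + 1 + 1 = coord x₀ (2 * l + 1) := by linear_combination h2
    rw [this]
    exact (hstep l hl).2.2.2.1
  · intro l hl
    obtain ⟨hz, hvz, -⟩ := hstep l hl
    refine ⟨1 / coord x₀ (2 * l), ?_, ?_⟩
    · rw [map_div₀, hvz, map_one, div_one]
    · have := sq_add_self_add_one_eq hz (coord_succ x₀ (2 * l))
      rw [hs l hl]
      linear_combination this + (coord x₀ (2 * l + 1) + 1) * h2
  · intro l hl
    obtain ⟨hz, hvz, hw, -, -, ht, -⟩ := hstep l hl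
    have hvτ := hlt (l + 1) hl
    have hτ : s (l + 1) * (s (l + 1) + 1) =
        (coord x₀ (2 * l) + 1) ^ 2 / (coord x₀ (2 * l) * coord x₀ (2 * l + 1)) := by
      rw [← ht]
      by_cases h : l + 1 < m
      · rw [hs _ h]
        change (coord x₀ (2 * l + 1 + 1) + 1) * (coord x₀ (2 * l + 1 + 1) + 1 + 1) = _
        linear_combination (coord x₀ (2 * l + 1 + 1) + 1) * h2
      · obtain rfl : l + 1 = m := by omega
        rw [hsm]
        rfl
    rw [hs l hl]
    exact inv_reduction (hnear l hl).1 hvz hw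
      (sq_add_self_add_one_eq hz (coord_succ x₀ (2 * l))) hτ hvτ

theorem evenStage_zero [CharP Ω 2] {n : ℕ} (hR : ReductionData v (functionField k x₀ n) m s W)
    (hs : s m = coord x₀ n) (hπ : v.IsUniformizerOn (functionField k x₀ n).toSubfield (s 0)) :
    EvenStage v (functionField k x₀ n) 0 m s W (coord x₀ n) (fun l => 1 / s l) (s 0) where
  uniformizer := hπ
  mem l _ hl := div_mem (one_mem _) (hR.s_mem l hl)
  mul_le_one l _ hl := by rw [mul_one_div_cancel (hR.s_ne_zero l hl), map_one]
  step l _ hl := hR.inv_s l hl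
  simple_pole := by rw [← map_mul, one_div_mul_cancel hπ.ne_zero, map_one]
  last := by
    have h1 : 1 / s m + (coord x₀ n + 1 + 1 / coord x₀ n) = s m + 1 := by
      rw [hs]
      linear_combination (1 / coord x₀ n) * CharTwo.two_eq_zero (R := Ω)
    rw [h1]
    exact v.map_add_le (hR.s_lt_one m le_rfl).le v.map_one.le

section Stages

variable [CharP Ω 2]

/-- Each ramified step followed by an unramified one raises the level by 2 and q by 1, from A_l =
1/s_l at level 2m up to q = m. -/
theorem exists_evenStage (hR : ReductionData v (functionField k x₀ (2 * m)) m s W)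
    (hs : s m = coord x₀ (2 * m))
    (hπ : v.IsUniformizerOn (functionField k x₀ (2 * m)).toSubfield (s 0)) {q : ℕ} (hq : q ≤ m) :
    ∃ A π, EvenStage v (functionField k x₀ (2 * m + 2 * q)) q m s W
      (coord x₀ (2 * m + 2 * q)) A π := by
  induction q with
  | zero => exact ⟨_, _, evenStage_zero hR hs hπ⟩
  | succ q ih =>
    obtain ⟨A, π, h⟩ := ih (by omega)
    obtain ⟨H, π', h'⟩ := h.next (hR.mono (functionField_mono (by omega))) (by omega)
    have hx : 1 < v (coord x₀ (2 * m + 2 * q + 1)) :=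
      one_lt_coord_of_lt (hs ▸ hR.s_ne_zero m le_rfl) (hs ▸ hR.s_lt_one m le_rfl) (by omega)
    obtain ⟨A', h''⟩ := h'.next (hR.mono (functionField_mono (by omega))) (by omega) hx
    exact ⟨A', π', h''⟩

/-- From the `i`-th step after the zero of `x_i` on, the last coordinate has a simple pole. -/
theorem exists_uniformizer_of_le (hR : ReductionData v (functionField k x₀ (2 * m)) m s W)
    (hm : 1 ≤ m) (hs : s m = coord x₀ (2 * m))
    (hπ : v.IsUniformizerOn (functionField k x₀ (2 * m)).toSubfield (s 0)) {j : ℕ}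
    (hj : 2 * m ≤ j) :
    ∃ π, v.IsUniformizerOn (functionField k x₀ (2 * m + j)).toSubfield π ∧
      v (coord x₀ (2 * m + j)) * v π = 1 := by
  have hx : ∀ j, 1 ≤ j → 1 < v (coord x₀ (2 * m + j)) := fun j hj =>
    one_lt_coord_of_lt (hs ▸ hR.s_ne_zero m le_rfl) (hs ▸ hR.s_lt_one m le_rfl) (by omega)
  induction hj with
  | refl =>
    -- At q = m the correcting sum is empty, so x_{4m} itself has a simple pole. Afterwards the
    -- inverse of the new coordinate is always a uniformizer.
    obtain ⟨A, π, h⟩ := exists_evenStage hR hs hπ (le_refl m)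
    refine ⟨π, h.uniformizer, ?_⟩
    have := h.simple_pole_rhs le_rfl
    rw [← map_rhs_of_one_lt (hx (2 * m) (by omega))]
    simpa using this
  | @step j hj ih =>
    obtain ⟨π, h1, h2⟩ := ih
    change 2 * m ≤ j at hj
    rw [← map_rhs_of_one_lt (hx j (by omega)), ← coord_succ] at h2
    refine ⟨_, h1.of_simple_pole (coord_mem k x₀ (le_refl (2 * m + j + 1)))
      (fun f hf => exists_eq_add_mul_coord hf) (coord_sq_add_self_mem _) h2, ?_⟩
    change v (coord x₀ (2 * m + j + 1)) * v (coord x₀ (2 * m + j + 1))⁻¹ = 1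
    rw [← map_mul, mul_inv_cancel₀ (h1.root_ne_zero h2), map_one]

theorem exists_simple_pole (hR : ReductionData v (functionField k x₀ (2 * m)) m s W)
    (hm : 1 ≤ m) (hs : s m = coord x₀ (2 * m))
    (hπ : v.IsUniformizerOn (functionField k x₀ (2 * m)).toSubfield (s 0)) {j : ℕ}
    (hj : (Even j ∧ j + 2 ≤ 2 * m) ∨ 2 * m ≤ j) :
    ∃ π, v.IsUniformizerOn (functionField k x₀ (2 * m + j)).toSubfield π ∧
      ∃ g ∈ functionField k x₀ (2 * m + j),
        v (coord x₀ (2 * m + j) + 1 + 1 / coord x₀ (2 * m + j) + (g ^ 2 + g)) * v π = 1 := by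
  rcases hj with ⟨hj, hjm⟩ | hj
  · obtain ⟨q, rfl⟩ := even_iff_exists_two_mul.1 hj
    obtain ⟨A, π, h⟩ := exists_evenStage hR hs hπ (q := q) (by omega)
    exact ⟨π, h.uniformizer, _, sum_mem (hR.mono (functionField_mono (by omega))).W_mem h.mem le_rfl,
      h.simple_pole_rhs (by omega)⟩
  · obtain ⟨π, h1, h2⟩ := exists_uniformizer_of_le hR hm hs hπ hj
    refine ⟨π, h1, 0, zero_mem _, ?_⟩
    rw [← map_rhs_of_one_lt (one_lt_of_mul_eq_one h2 h1.lt_one)] at h2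
    simpa using h2

theorem exists_regular (hR : ReductionData v (functionField k x₀ (2 * m)) m s W)
    (hs : s m = coord x₀ (2 * m))
    (hπ : v.IsUniformizerOn (functionField k x₀ (2 * m)).toSubfield (s 0)) {j : ℕ}
    (hj : Odd j) (hjm : j + 1 ≤ 2 * m) :
    ∃ π, v.IsUniformizerOn (functionField k x₀ (2 * m + j)).toSubfield π ∧
      ∃ g ∈ functionField k x₀ (2 * m + j),
        v (coord x₀ (2 * m + j) + 1 + 1 / coord x₀ (2 * m + j) + (g ^ 2 + g)) ≤ 1 := by
  obtain ⟨q, rfl⟩ := hj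
  have hx : 1 < v (coord x₀ (2 * m + 2 * q + 1)) :=
    one_lt_coord_of_lt (hs ▸ hR.s_ne_zero m le_rfl) (hs ▸ hR.s_lt_one m le_rfl) (by omega)
  obtain ⟨A, π, h⟩ := exists_evenStage hR hs hπ (q := q) (by omega)
  obtain ⟨H, π', h'⟩ := h.next (hR.mono (functionField_mono (by omega))) (by omega)
  obtain ⟨m, rfl⟩ : ∃ m', m = m' + 1 := ⟨m - 1, by omega⟩
  refine ⟨π', h'.uniformizer, _, mul_mem (add_mem ?_ (one_mem _)) (h'.mem m (by omega) (by omega)),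
    h'.regular_rhs (by omega) hx⟩
  exact functionField_mono (by omega) (hR.W_mem m (by omega))

end Stages

end ArtinSchreierTower

theorem CurvePoint.HasValue.sub_mem_nonunits {k K : Type*} [Field k] [Field K] [Algebra k K]
    {P : CurvePoint k K} {f : K} {c : k} (h : P.HasValue f (c : OnePoint k)) :
    f - algebraMap k K c ∈ P.ring.nonunits := by
  rcases h with ⟨h, -⟩ | ⟨c', h, hc⟩
  · exact absurd h (OnePoint.coe_ne_infty c)
  · rwa [OnePoint.coe_injective h]

/-! ### Passage from valuations of Ω to points of the curves -/

namespace ArtinSchreierTower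

section Conclusion

variable {k Ω : Type*} [Field k] [Field Ω] [IsAlgClosed Ω] [Algebra k Ω] {x₀ : Ω}
  {n : ℕ} {P : Point k x₀ n} {B : ValuationSubring Ω}

theorem isUniformizerOn_top (hB : B.comap (algebraMap (functionField k x₀ n) Ω) = P.ring)
    {π : functionField k x₀ n}
    (hπ : B.valuation.IsUniformizerOn (functionField k x₀ n).toSubfield π) :
    P.ring.valuation.IsUniformizerOn ⊤ π := by
  have hE : (algebraMap (functionField k x₀ n) Ω).fieldRange =
      (functionField k x₀ n).toSubfield := by
    ext f
    exact ⟨fun ⟨g, hg⟩ => hg ▸ g.2, fun hf => ⟨⟨f, hf⟩, rfl⟩⟩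
  rw [← hE] at hπ
  exact (Valuation.IsUniformizerOn.map (ValuationSubring.isEquiv_comap_of_comap_eq hB)).1 hπ

theorem map_coord_sub_lt_one (hB : B.comap (algebraMap (functionField k x₀ n) Ω) = P.ring)
    {a : Fin (n + 1) → OnePoint k} (hP : HasIndexSequence P a) {l : ℕ} (hl : l < n + 1) {c : k}
    (hc : a ⟨l, hl⟩ = (c : OnePoint k)) : B.valuation (coord x₀ l - algebraMap k Ω c) < 1 := by
  have h := hP ⟨l, hl⟩
  rw [hc] at h
  exact (ValuationSubring.isEquiv_comap_of_comap_eq hB).lt_one_iff_lt_one.1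
    ((ValuationSubring.mem_nonunits_iff P.ring).1 h.sub_mem_nonunits)

variable [CharP Ω 2]

theorem exists_eq_add_mul_root {g : functionField k x₀ n} (f : functionField k x₀ (n + 1)) :
    ∃ a b : functionField k x₀ n, f = algebraMap _ (functionField k x₀ (n + 1)) a +
      algebraMap _ (functionField k x₀ (n + 1)) b *
        (coordFun k x₀ (n + 1) (Fin.last _) + algebraMap _ (functionField k x₀ (n + 1)) g) := by
  obtain ⟨a, ha, b, hb, he⟩ := exists_eq_add_mul_coord_add f.2 g.2
  refine ⟨⟨a, ha⟩, ⟨b, hb⟩, Subtype.ext ?_⟩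
  rw [IntermediateField.coe_add, IntermediateField.coe_mul, IntermediateField.coe_add,
    coe_stepAlgebra, coe_stepAlgebra, coe_stepAlgebra]
  exact he

/-- The root y + g generates the same cover, and its right-hand side is the corrected one to which
the local criteria apply. -/
theorem root_equation (g : functionField k x₀ n) :
    (coordFun k x₀ (n + 1) (Fin.last _) + algebraMap _ (functionField k x₀ (n + 1)) g) ^ 2 +
      (coordFun k x₀ (n + 1) (Fin.last _) + algebraMap _ (functionField k x₀ (n + 1)) g) =
    algebraMap _ (functionField k x₀ (n + 1)) (coordFun k x₀ n (Fin.last n) + 1 +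
      1 / coordFun k x₀ n (Fin.last n) + (g ^ 2 + g)) := by
  refine Subtype.ext ?_
  have hx : ((coordFun k x₀ (n + 1) (Fin.last _) : functionField k x₀ (n + 1)) : Ω) =
    coord x₀ (n + 1) := rfl
  have hx' : ((coordFun k x₀ n (Fin.last _) : functionField k x₀ n) : Ω) = coord x₀ n := rfl
  rw [coe_stepAlgebra]
  push_cast
  rw [coe_stepAlgebra, hx, hx', ← coord_succ]
  linear_combination (coord x₀ (n + 1) * g) * CharTwo.two_eq_zero (R := Ω)

theorem charP_functionField : CharP (functionField k x₀ n) 2 :=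
  ((algebraMap (functionField k x₀ n) Ω).charP_iff
    (algebraMap (functionField k x₀ n) Ω).injective 2).2 inferInstance

theorem isTotallyRamified_step (hB : B.comap (algebraMap (functionField k x₀ n) Ω) = P.ring)
    {π : Ω} (hπ : B.valuation.IsUniformizerOn (functionField k x₀ n).toSubfield π) {g : Ω}
    (hg : g ∈ functionField k x₀ n)
    (h : B.valuation (coord x₀ n + 1 + 1 / coord x₀ n + (g ^ 2 + g)) * B.valuation π = 1) :
    P.IsTotallyRamified (functionField k x₀ (n + 1)) ∧
      P.ramContribution (functionField k x₀ (n + 1)) = 2 := by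
  have := charP_functionField (k := k) (x₀ := x₀) (n := n + 1)
  lift g to functionField k x₀ n using hg
  lift π to functionField k x₀ n using hπ.mem
  refine CurvePoint.isTotallyRamified_of_artinSchreier (isUniformizerOn_top hB hπ) _ ?_
    (root_equation g) exists_eq_add_mul_root
  rw [← map_mul] at h ⊢
  exact (ValuationSubring.isEquiv_comap_of_comap_eq hB).eq_one_iff_eq_one.2 h

theorem isUnramified_step (hB : B.comap (algebraMap (functionField k x₀ n) Ω) = P.ring)
    {π : Ω} (hπ : B.valuation.IsUniformizerOn (functionField k x₀ n).toSubfield π) {g : Ω}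
    (hg : g ∈ functionField k x₀ n)
    (h : B.valuation (coord x₀ n + 1 + 1 / coord x₀ n + (g ^ 2 + g)) ≤ 1) :
    P.IsUnramified (functionField k x₀ (n + 1)) := by
  have := charP_functionField (k := k) (x₀ := x₀) (n := n + 1)
  lift g to functionField k x₀ n using hg
  lift π to functionField k x₀ n using hπ.mem
  refine CurvePoint.isUnramified_of_artinSchreier (isUniformizerOn_top hB hπ) _ ?_
    (root_equation g) exists_eq_add_mul_root
  exact (ValuationSubring.isEquiv_comap_of_comap_eq hB).le_one_iff_le_one.2 h

end Conclusion

end ArtinSchreierTower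

open ArtinSchreierTower in
theorem mainTheorem5 {k Ω : Type*} [Field k] [Algebra (ZMod 2) k] [IsAlgClosure (ZMod 2) k]
    [Field Ω] [IsAlgClosed Ω] [Algebra k Ω] (x₀ : Ω) (hx₀ : Transcendental k x₀)
    (i j : ℕ) (hi : 1 ≤ i) (a : Fin i → OnePoint k) (ha : a ⟨0, hi⟩ = ((1 : k) : OnePoint k))
    (P : Point k x₀ (i + j)) (hP : HasIndexSequence P (poleSequence j a)) :
    ((Even j ∧ j + 2 ≤ i) ∨ i ≤ j →
      P.IsTotallyRamified (functionField k x₀ (i + j + 1)) ∧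
        P.ramContribution (functionField k x₀ (i + j + 1)) = 2) ∧
    (Odd j ∧ j + 1 ≤ i → P.IsUnramified (functionField k x₀ (i + j + 1))) := by
  have : CharP k 2 := charP_of_injective_algebraMap (algebraMap (ZMod 2) k).injective 2
  have : CharP Ω 2 := charP_of_injective_algebraMap (algebraMap k Ω).injective 2
  -- One valuation of Ω above P lets the whole tower be treated inside a single field, without
  -- naming the images of P on the lower curves.
  obtain ⟨B, hB⟩ := ValuationSubring.exists_comap_eq (algebraMap (functionField k x₀ (i + j)) Ω)
    P.ring
  have hk : ∀ c : k, B.valuation (algebraMap k Ω c) ≤ 1 := fun c =>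
    (ValuationSubring.isEquiv_comap_of_comap_eq hB).le_one_iff_le_one.1
      ((P.ring.valuation_le_one_iff _).2 (P.const_mem c))
  have hv0 : B.valuation (x₀ - algebraMap k Ω 1) < 1 :=
    map_coord_sub_lt_one hB hP (l := 0) (by omega) (by
      rw [poleSequence, dif_pos (show 0 < i from hi)]
      exact ha)
  have hvi : B.valuation (coord x₀ i) < 1 := by
    have := map_coord_sub_lt_one hB hP (l := i) (by omega) (c := 0) (by simp [poleSequence])
    rwa [map_zero, sub_zero] at this
  -- Transcendence of x₀ enters only here: x₀ - 1 must be nonzero to be a uniformizer on the line.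
  have h0 : x₀ - algebraMap k Ω 1 ≠ 0 := fun h =>
    hx₀ (by rw [sub_eq_zero.1 h]; exact isAlgebraic_algebraMap 1)
  have hπ := isUniformizerOn_functionField_zero hk 1 h0 hv0
  rw [map_one, CharTwo.sub_eq_add] at h0 hv0 hπ
  obtain ⟨m, rfl⟩ := exists_eq_two_mul h0 hv0 hvi
  have hπm := isUniformizerOn_of_map_coord_eq_one hπ fun n hn => map_coord_eq_one h0 hv0 hvi hn
  obtain ⟨s, W, hR, hs0, hsm⟩ := exists_reductionData (k := k) (by omega) h0 hv0 hvi
  rw [← hs0] at hπm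
  constructor
  · intro hj
    obtain ⟨π, h1, g, hg, h2⟩ := exists_simple_pole hR (by omega) hsm hπm hj
    exact isTotallyRamified_step hB h1 hg h2
  · rintro ⟨hj, hjm⟩
    obtain ⟨π, h1, g, hg, h2⟩ := exists_regular hR hsm hπm hj hjm
    exact isUnramified_step hB h1 hg h2
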